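/- **Definitions.** Let $S$ be a left cancellative monoid with identity $e$. Its left inverse hull $I_\ell(S)$ is the inverse semigroup of partial bijections of $S$ generated by the left translations $t\mapsto st$, $s\in S$; we identify $s$ with the corresponding translation. Let $\mathcal J(S)$ be the collection of constructible right ideals, that is, of the sets $X\subseteq S$ such that the identity map $p_X$ of $X$ lies in $I_\ell(S)$, and let $\bar{\mathcal J}(S)$ be the collection of the sets $X\setminus\bigcup_{i=1}^m X_i$ with $m\ge 0$ and $X,X_1,\dots,X_m\in\mathcal J(S)$. The monoid $S$ is called *C\*-regular* if, whenever $h_1,\dots,h_n\in I_\ell(S)$ and $X\in\bar{\mathcal J}(S)$ satisfy $\emptyset\neq X\subseteq\bigcup_{k=1}^n\{s\in S: h_ks=s\}$, there are $Y_1,\dots,Y_l\in\bar{\mathcal J}(S)$ and indices $1\le k_j\le n$ such that $X\subseteq\bigcup_{j=1}^l Y_j$ and $h_{k_j}|_{Y_j}=\mathrm{id}$ for all $j$. Let $\Omega(S)$ be the closure of $\{\chi_s: s\in S\}$, where $\chi_s(p_X)=\mathbb 1_X(s)$, in the compact space of nonzero semigroup homomorphisms $\chi\colon\{p_X: X\in\mathcal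 J(S)\}\to\{0,1\}$ with the topology of pointwise convergence. The groupoid $\mathcal G(S)$ has unit space $\Omega(S)$ and consists of the classes $[g,\chi]$ of pairs $(g,\chi)\in I_\ell(S)\times\Omega(S)$ with $\chi(g^{-1}g)=1$, where $[g,\chi]=[h,\chi]$ if and only if there are $X,X_1,\dots,X_m\in\mathcal J(S)$ with $\chi(p_X)=1$ and $\chi(p_{X_i})=0$ for all $i$ such that $g=h$ on $X\setminus\bigcup_{i}X_i$. The source of $[g,\chi]$ is $\chi$, its range is $\chi(g^{-1}\cdot g)$, and $[h,\psi][g,\chi]=[hg,\chi]$ if $\psi=\chi(g^{-1}\cdot g)$. The sets $D(g,U)=\{[g,\chi]:\chi\in U\}$, for $g\in I_\ell(S)$ and $U$ an open subset of $\{\chi\in\Omega(S):\chi(g^{-1}g)=1\}$, form a basis of the topology of $\mathcal G(S)$. The C\*-algebra $C^*_r(\mathcal G(S))$ is the completion of the convolution algebra $C_c(\mathcal G(S))$ (the span of the spaces $C_c(V)$ for open Hausdorff subsets $V\subseteq\mathcal G(S)$, functions being extended by zero) with respect to the norm $\sup_{x\in\Omega(S)}\|\rho_x(f)\|$, where $\rho_x$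 is the representation on $\ell^2(\mathcal G(S)_x)$, $\mathcal G(S)_x$ being the set of arrows with source $x$, given by $(\rho_x(f)\xi)(g)=\sum_{r(h)=r(g)}f(h)\xi(h^{-1}g)$. The C\*-algebra $C^*_r(S)\subseteq B(\ell^2(S))$ is generated by the operators $\lambda_s\delta_t=\delta_{st}$, $s\in S$. Identifying $S$ with $\mathcal G(S)_{\chi_e}$ by the bijection $s\mapsto[s,\chi_e]$, one views $\rho_{\chi_e}$ as a representation of $C^*_r(\mathcal G(S))$ on $\ell^2(S)$. **Proposition.** Consider the monoid given by the presentation $$T=\langle a,b,c,x_n,y_n\ (n\in\mathbb Z):\ abx_n=bx_n,\ aby_n=by_{n+1},\ cbx_n=bx_{n+1},\ cby_n=by_n\ (n\in\mathbb Z)\rangle .$$ Then $T$ is left cancellative. It is not C\*-regular. Furthermore, $\rho_{\chi_e}$ defines a $*$-homomorphism $\rho_{\chi_e}\colon C^*_r(\mathcal G(T))\to C^*_r(T)$, and this homomorphism has nontrivial kernel: the right ideal $X=\bigcup_{n\in\mathbb Z}bx_nT\cup\bigcup_{n\in\mathbb Z}by_nT$ is constructible and, with $U=\{\eta\in\Omega(T):\eta(p_X)=1\}$,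 the element $$(\mathbb 1_{D(a,\Omega(T))}-\mathbb 1_{\Omega(T)})*(\mathbb 1_{D(c,\Omega(T))}-\mathbb 1_{\Omega(T)})*\mathbb 1_U\in C_c(\mathcal G(T))\subseteq C^*_r(\mathcal G(T))$$ is nonzero and lies in $\ker\rho_{\chi_e}$. -/

import Mathlib

noncomputable section

open CategoryTheory
open scoped ENNReal

namespace GpdCStar

/-- The Hilbert space `ℓ²(ι)`. -/
abbrev Ell2 (ι : Type*) : Type _ := lp (fun _ : ι => ℂ) 2

/-- The bounded operators on `ℓ²(ι)`. -/
abbrev BEll2 (ι : Type*) : Type _ := Ell2 ι →L[ℂ] Ell2 ι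

section Kernel

variable {ι : Type*}

/-- All row sums and all column sums of the matrix `(‖k i j‖)` are at most `C`. -/
def RowColBound (k : ι → ι → ℂ) (C : ℝ) : Prop :=
  (∀ (i : ι) (s : Finset ι), ∑ j ∈ s, ‖k i j‖ ≤ C) ∧
  (∀ (j : ι) (s : Finset ι), ∑ i ∈ s, ‖k i j‖ ≤ C)

variable {k : ι → ι → ℂ} {C : ℝ}

lemma sum_sq_le_norm_sq (ξ : Ell2 ι) (s : Finset ι) : ∑ j ∈ s, ‖ξ j‖ ^ 2 ≤ ‖ξ‖ ^ 2 := by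
  have h := lp.sum_rpow_le_norm_rpow (p := 2) (by norm_num) ξ s
  simpa using h

lemma RowColBound.nonneg (h : RowColBound k C) (i : ι) : 0 ≤ C := by
  simpa using h.1 i ∅

lemma RowColBound.summable_norm (h : RowColBound k C) (ξ : Ell2 ι) (i : ι) :
    Summable fun j => ‖k i j * ξ j‖ := by
  refine summable_of_sum_le (c := C * ‖ξ‖) (fun _ => norm_nonneg _) fun s => ?_
  calc ∑ j ∈ s, ‖k i j * ξ j‖ ≤ ∑ j ∈ s, ‖k i j‖ * ‖ξ‖ := by
        refine Finset.sum_le_sum fun j _ => ?_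
        rw [norm_mul]
        gcongr
        exact lp.norm_apply_le_norm (by norm_num) ξ j
    _ = (∑ j ∈ s, ‖k i j‖) * ‖ξ‖ := by rw [Finset.sum_mul]
    _ ≤ C * ‖ξ‖ := by gcongr; exact h.1 i s

lemma RowColBound.summable (h : RowColBound k C) (ξ : Ell2 ι) (i : ι) :
    Summable fun j => k i j * ξ j := (h.summable_norm ξ i).of_norm

lemma RowColBound.summable_sq (h : RowColBound k C) (ξ : Ell2 ι) (i : ι) :
    Summable fun j => ‖k i j‖ * ‖ξ j‖ ^ 2 := by
  refine summable_of_sum_le (c := C * ‖ξ‖ ^ 2) (fun _ => by positivity) fun s => ?_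
  calc ∑ j ∈ s, ‖k i j‖ * ‖ξ j‖ ^ 2 ≤ ∑ j ∈ s, ‖k i j‖ * ‖ξ‖ ^ 2 := by
        refine Finset.sum_le_sum fun j _ => ?_
        gcongr
        exact lp.norm_apply_le_norm (by norm_num) ξ j
    _ = (∑ j ∈ s, ‖k i j‖) * ‖ξ‖ ^ 2 := by rw [Finset.sum_mul]
    _ ≤ C * ‖ξ‖ ^ 2 := by gcongr; exact h.1 i s

lemma RowColBound.row (h : RowColBound k C) (ξ : Ell2 ι) (i : ι) :
    ‖∑' j, k i j * ξ j‖ ^ 2 ≤ C * ∑' j, ‖k i j‖ * ‖ξ j‖ ^ 2 := by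
  have hC := h.nonneg i
  have h1 : ‖∑' j, k i j * ξ j‖ ≤ ∑' j, ‖k i j * ξ j‖ := norm_tsum_le_tsum_norm (h.summable_norm ξ i)
  have h2 : ∑' j, ‖k i j * ξ j‖ ≤ √(C * ∑' j, ‖k i j‖ * ‖ξ j‖ ^ 2) := by
    refine (h.summable_norm ξ i).tsum_le_of_sum_le fun s => Real.le_sqrt_of_sq_le ?_
    calc (∑ j ∈ s, ‖k i j * ξ j‖) ^ 2
        ≤ (∑ j ∈ s, ‖k i j‖) * ∑ j ∈ s, ‖k i j‖ * ‖ξ j‖ ^ 2 := by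
          refine Finset.sum_sq_le_sum_mul_sum_of_sq_le_mul s (fun _ _ => by positivity)
            (fun _ _ => by positivity) fun j _ => ?_
          exact le_of_eq (by rw [norm_mul]; ring)
      _ ≤ C * ∑' j, ‖k i j‖ * ‖ξ j‖ ^ 2 := by
          gcongr
          · exact h.1 i s
          · exact (h.summable_sq ξ i).sum_le_tsum s fun _ _ => by positivity
  have h3 : 0 ≤ C * ∑' j, ‖k i j‖ * ‖ξ j‖ ^ 2 :=
    mul_nonneg hC (tsum_nonneg fun _ => by positivity)
  calc ‖∑' j, k i j * ξ j‖ ^ 2 ≤ √(C * ∑' j, ‖k i j‖ * ‖ξ j‖ ^ 2) ^ 2 := by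
        gcongr; exact h1.trans h2
    _ = _ := Real.sq_sqrt h3

lemma RowColBound.sum_le (h : RowColBound k C) (ξ : Ell2 ι) (s : Finset ι) :
    ∑ i ∈ s, ‖∑' j, k i j * ξ j‖ ^ 2 ≤ (C * ‖ξ‖) ^ 2 := by
  rcases s.eq_empty_or_nonempty with rfl | ⟨i₀, -⟩
  · simpa using sq_nonneg (C * ‖ξ‖)
  have hC := h.nonneg i₀
  calc ∑ i ∈ s, ‖∑' j, k i j * ξ j‖ ^ 2 ≤ ∑ i ∈ s, C * ∑' j, ‖k i j‖ * ‖ξ j‖ ^ 2 :=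
        Finset.sum_le_sum fun i _ => h.row ξ i
    _ = C * ∑' j, ∑ i ∈ s, ‖k i j‖ * ‖ξ j‖ ^ 2 := by
        rw [← Finset.mul_sum, Summable.tsum_finsetSum fun i _ => h.summable_sq ξ i]
    _ ≤ C * (C * ‖ξ‖ ^ 2) := by
        gcongr
        refine (summable_sum fun i _ => h.summable_sq ξ i).tsum_le_of_sum_le fun t => ?_
        calc ∑ j ∈ t, ∑ i ∈ s, ‖k i j‖ * ‖ξ j‖ ^ 2 = ∑ j ∈ t, (∑ i ∈ s, ‖k i j‖) * ‖ξ j‖ ^ 2 := by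
              simp_rw [Finset.sum_mul]
          _ ≤ ∑ j ∈ t, C * ‖ξ j‖ ^ 2 := by
              refine Finset.sum_le_sum fun j _ => ?_
              gcongr; exact h.2 j s
          _ = C * ∑ j ∈ t, ‖ξ j‖ ^ 2 := by rw [Finset.mul_sum]
          _ ≤ C * ‖ξ‖ ^ 2 := by gcongr; exact sum_sq_le_norm_sq ξ t
    _ = _ := by ring

/-- The bounded operator on `ℓ²(ι)` with matrix `k`, `(Tξ)(i) = ∑ⱼ k(i,j) ξ(j)`. -/
def kernelOp (k : ι → ι → ℂ) (C : ℝ) (h : RowColBound k C) : BEll2 ι :=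
  LinearMap.mkContinuous
    { toFun := fun ξ => ⟨fun i => ∑' j, k i j * ξ j, by
        refine memℓp_gen' (C := (C * ‖ξ‖) ^ 2) fun s => ?_
        simpa using h.sum_le ξ s⟩
      map_add' := fun ξ η => by
        ext i
        simp only [lp.coeFn_add, Pi.add_apply, mul_add]
        exact (h.summable ξ i).tsum_add (h.summable η i)
      map_smul' := fun c ξ => by
        ext i
        simp only [lp.coeFn_smul, Pi.smul_apply, smul_eq_mul, RingHom.id_apply]
        rw [← tsum_mul_left]
        exact tsum_congr fun j => by ring }
    |C| fun ξ => by
      refine lp.norm_le_of_forall_sum_le (by norm_num) (by positivity) fun s => ?_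
      have := h.sum_le ξ s
      rw [← sq_abs, abs_mul, abs_norm] at this
      simpa using this

lemma kernelOp_apply (h : RowColBound k C) (ξ : Ell2 ι) (i : ι) :
    kernelOp k C h ξ i = ∑' j, k i j * ξ j := rfl

lemma norm_kernelOp_le (h : RowColBound k C) : ‖kernelOp k C h‖ ≤ |C| :=
  LinearMap.mkContinuous_norm_le _ (abs_nonneg _) _

end Kernel

section Perm

variable {ι κ : Type*}

lemma memℓp_comp_injective {f : ι → κ} (hf : Function.Injective f) (ξ : Ell2 κ) :
    Memℓp (fun i => ξ (f i)) 2 := by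
  refine memℓp_gen' (C := ‖ξ‖ ^ 2) fun s => ?_
  have := sum_sq_le_norm_sq ξ (s.map ⟨f, hf⟩)
  simpa using this

/-- The unitary `ℓ²(ι) → ℓ²(κ)`, `δ_i ↦ δ_{e i}`, defined by a bijection `e : ι ≃ κ`. -/
def ell2Congr (e : ι ≃ κ) : Ell2 ι ≃ₗᵢ[ℂ] Ell2 κ where
  toFun ξ := ⟨fun j => ξ (e.symm j), memℓp_comp_injective e.symm.injective ξ⟩
  invFun ξ := ⟨fun i => ξ (e i), memℓp_comp_injective e.injective ξ⟩
  map_add' _ _ := rfl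
  map_smul' _ _ := rfl
  left_inv ξ := by ext i; simp
  right_inv ξ := by ext i; simp
  norm_map' ξ := by
    have h1 := lp.norm_rpow_eq_tsum (p := 2) (by norm_num) ξ
    have h2 := lp.norm_rpow_eq_tsum (p := 2) (E := fun _ : κ => ℂ) (by norm_num)
      ⟨fun j => ξ (e.symm j), memℓp_comp_injective e.symm.injective ξ⟩
    have h3 := e.symm.tsum_eq fun i => ‖ξ i‖ ^ (2 : ℝ≥0∞).toReal
    rw [h3, ← h1] at h2
    have h4 : ‖(⟨fun j => ξ (e.symm j), memℓp_comp_injective e.symm.injective ξ⟩ : Ell2 κ)‖ = ‖ξ‖ := by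
      simpa using h2
    exact h4

end Perm

section Product

variable {X : Type*} (A : X → Type*) [∀ x, NonUnitalCStarAlgebra (A x)]

/-- The C*-algebra of bounded families `(Tₓ)ₓ`, `Tₓ ∈ Aₓ`, with the norm `supₓ ‖Tₓ‖`. -/
abbrev CStarProd : Type _ := lp A ∞

/-- The coordinate maps. -/
def CStarProd.eval (x : X) : CStarProd A →⋆ₙₐ[ℂ] A x where
  toFun z := z x
  map_smul' _ _ := rfl
  map_zero' := rfl
  map_add' _ _ := rfl
  map_mul' _ _ := rfl
  map_star' _ := rfl

variable {A}

/-- A bounded family of elements, as an element of the product. -/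
def CStarProd.mk (T : ∀ x, A x) (C : ℝ) (hT : ∀ x, ‖T x‖ ≤ C) : CStarProd A :=
  ⟨T, memℓp_infty ⟨C, by rintro _ ⟨x, rfl⟩; exact hT x⟩⟩

end Product

section Groupoid

/-- The set of arrows of a groupoid `𝒢` with unit space `X`. -/
structure Arr (X : Type*) [Groupoid X] where
  /-- The source of the arrow. -/
  src : X
  /-- The range of the arrow. -/
  rng : X
  /-- The arrow itself. -/
  hom : src ⟶ rng

/-- The set `𝒢ₓ = s⁻¹(x)` of arrows with source `x`. -/
abbrev SrcFiber {X : Type*} [Groupoid X] (x : X) : Type _ := Σ y : X, (x ⟶ y)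

/-- The set `𝒢ʸ = r⁻¹(y)` of arrows with range `y`. -/
abbrev RngFiber {X : Type*} [Groupoid X] (y : X) : Type _ := Σ z : X, (z ⟶ y)

variable {X : Type*} [Groupoid X]

/-- The sums of `‖f‖` along the source and range fibres are at most `C`. -/
def FiberBound (f : Arr X → ℂ) (C : ℝ) : Prop :=
  (∀ (x : X) (s : Finset (SrcFiber x)), ∑ g ∈ s, ‖f ⟨x, g.1, g.2⟩‖ ≤ C) ∧
  (∀ (y : X) (s : Finset (RngFiber y)), ∑ g ∈ s, ‖f ⟨g.1, y, g.2⟩‖ ≤ C)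

/-- The matrix `(g, k) ↦ f(g k⁻¹)` on `𝒢ₓ`. -/
def regKernel (f : Arr X → ℂ) (x : X) (g k : SrcFiber x) : ℂ :=
  f ⟨k.1, g.1, Groupoid.inv k.2 ≫ g.2⟩

/-- The bijection `𝒢ₓ → 𝒢^{r(g)}`, `k ↦ g k⁻¹`. -/
def divEquiv {x : X} (g : SrcFiber x) : SrcFiber x ≃ RngFiber g.1 where
  toFun k := ⟨k.1, Groupoid.inv k.2 ≫ g.2⟩
  invFun h := ⟨h.1, g.2 ≫ Groupoid.inv h.2⟩
  left_inv k := by simp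
  right_inv h := by simp

/-- The bijection `𝒢ₓ → 𝒢_{r(k)}`, `g ↦ g k⁻¹`. -/
def mulInvEquiv {x : X} (k : SrcFiber x) : SrcFiber x ≃ SrcFiber k.1 where
  toFun g := ⟨g.1, Groupoid.inv k.2 ≫ g.2⟩
  invFun h := ⟨h.1, k.2 ≫ h.2⟩
  left_inv g := by simp
  right_inv h := by simp

lemma FiberBound.rowColBound {f : Arr X → ℂ} {C : ℝ} (h : FiberBound f C) (x : X) :
    RowColBound (regKernel f x) C := by
  refine ⟨fun g s => ?_, fun k s => ?_⟩
  · have := h.2 g.1 (s.map (divEquiv g).toEmbedding)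
    simpa [regKernel, divEquiv] using this
  · have := h.1 k.1 (s.map (mulInvEquiv k).toEmbedding)
    simpa [regKernel, mulInvEquiv] using this

variable (X) [TopologicalSpace (Arr X)]

/-- Every arrow has an open neighbourhood on which the source and range maps are injective, as is
the case when these maps are local homeomorphisms. This is what makes the operators `ρₓ(f)` bounded
for all `f ∈ C_c(𝒢)`. -/
class HasOpenBisections : Prop where
  exists_bisection : ∀ γ : Arr X, ∃ V : Set (Arr X),
    IsOpen V ∧ γ ∈ V ∧ Set.InjOn Arr.src V ∧ Set.InjOn Arr.rng V

/-- `f` is (the extension by zero of) a continuous compactly supported function on some open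
Hausdorff subset `V` of `𝒢`. -/
def IsBasicCc (f : Arr X → ℂ) : Prop :=
  ∃ V : Set (Arr X), IsOpen V ∧ T2Space V ∧ ContinuousOn f V ∧
    ∃ K : Set (Arr X), IsCompact K ∧ K ⊆ V ∧ ∀ γ, γ ∉ K → f γ = 0

/-- The space `C_c(𝒢)` of a not necessarily Hausdorff groupoid `𝒢`: the span of the spaces
`C_c(V)` for the open Hausdorff subsets `V ⊆ 𝒢`. -/
def Cc : Submodule ℂ (Arr X → ℂ) := Submodule.span ℂ {f | IsBasicCc X f}

variable {X}

lemma sum_le_of_cover {α ι : Type*} (F : α → ℝ) (hF : ∀ a, 0 ≤ F a) (M : ℝ) (hM : 0 ≤ M)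
    (hFM : ∀ a, F a ≤ M) (t : Finset ι) (P : ι → α → Prop)
    (hP : ∀ i a b, P i a → P i b → a = b) (hcov : ∀ a, F a ≠ 0 → ∃ i ∈ t, P i a) (s : Finset α) :
    ∑ a ∈ s, F a ≤ t.card * M := by
  classical
  calc ∑ a ∈ s, F a ≤ ∑ a ∈ s, ∑ i ∈ t, (if P i a then F a else 0) := by
        refine Finset.sum_le_sum fun a _ => ?_
        by_cases h : F a = 0
        · rw [h]; exact Finset.sum_nonneg fun i _ => by split_ifs <;> simp
        · obtain ⟨i, hi, hPi⟩ := hcov a h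
          refine le_trans ?_ (Finset.single_le_sum (fun j _ => ?_) hi)
          · rw [if_pos hPi]
          · split_ifs
            · exact hF a
            · exact le_rfl
    _ = ∑ i ∈ t, ∑ a ∈ s, (if P i a then F a else 0) := Finset.sum_comm
    _ ≤ ∑ i ∈ t, M := by
        refine Finset.sum_le_sum fun i _ => ?_
        by_cases h : ∃ a ∈ s, P i a
        · obtain ⟨a, ha, hPa⟩ := h
          rw [Finset.sum_eq_single a]
          · rw [if_pos hPa]; exact hFM a
          · intro b _ hb
            rw [if_neg fun hPb => hb (hP i b a hPb hPa)]
          · exact fun h => absurd ha h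
        · push Not at h
          rw [Finset.sum_eq_zero fun a ha => if_neg (h a ha)]
          exact hM
    _ = t.card * M := by simp

lemma IsBasicCc.exists_fiberBound [HasOpenBisections X] {f : Arr X → ℂ} (hf : IsBasicCc X f) :
    ∃ C, FiberBound f C := by
  obtain ⟨V, -, -, hc, K, hK, hKV, h0⟩ := hf
  obtain ⟨M, hM⟩ := hK.exists_bound_of_continuousOn (hc.mono hKV)
  choose B hBo hBm hBs hBr using HasOpenBisections.exists_bisection (X := X)
  obtain ⟨t, ht⟩ := hK.elim_finite_subcover B hBo fun γ _ => Set.mem_iUnion.2 ⟨γ, hBm γ⟩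
  have hFM : ∀ γ, ‖f γ‖ ≤ max M 0 := fun γ => by
    by_cases h : γ ∈ K
    · exact (hM γ h).trans (le_max_left _ _)
    · rw [h0 γ h]; simp
  have hcov : ∀ γ, ‖f γ‖ ≠ 0 → ∃ i ∈ t, γ ∈ B i := fun γ h => by
    have : γ ∈ K := by_contra fun hK => h (by rw [h0 γ hK, norm_zero])
    simpa using ht this
  refine ⟨t.card * max M 0, fun x s => ?_, fun y s => ?_⟩
  · refine sum_le_of_cover (fun g : SrcFiber x => ‖f ⟨x, g.1, g.2⟩‖) (fun _ => norm_nonneg _) _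
      (le_max_right _ _) (fun _ => hFM _) t (fun i g => (⟨x, g.1, g.2⟩ : Arr X) ∈ B i)
      (fun i g h hg hh => ?_) (fun g hg => hcov _ hg) s
    obtain ⟨y, g⟩ := g
    obtain ⟨z, h⟩ := h
    have := hBs i hg hh rfl
    simpa using this
  · refine sum_le_of_cover (fun g : RngFiber y => ‖f ⟨g.1, y, g.2⟩‖) (fun _ => norm_nonneg _) _
      (le_max_right _ _) (fun _ => hFM _) t (fun i g => (⟨g.1, y, g.2⟩ : Arr X) ∈ B i)
      (fun i g h hg hh => ?_) (fun g hg => hcov _ hg) s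
    obtain ⟨x, g⟩ := g
    obtain ⟨z, h⟩ := h
    have := hBr i hg hh rfl
    simp only [Arr.mk.injEq] at this
    obtain ⟨rfl, -, h⟩ := this
    simpa using h

lemma exists_fiberBound [HasOpenBisections X] {f : Arr X → ℂ} (hf : f ∈ Cc X) :
    ∃ C, FiberBound f C := by
  induction hf using Submodule.span_induction with
  | mem f hf => exact IsBasicCc.exists_fiberBound hf
  | zero => exact ⟨0, by simp [FiberBound]⟩
  | add f g _ _ hf hg =>
    obtain ⟨C, hC⟩ := hf
    obtain ⟨D, hD⟩ := hg
    refine ⟨C + D, fun x s => ?_, fun x s => ?_⟩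
    · refine (Finset.sum_le_sum fun _ _ => norm_add_le _ _).trans ?_
      rw [Finset.sum_add_distrib]
      exact add_le_add (hC.1 x s) (hD.1 x s)
    · refine (Finset.sum_le_sum fun _ _ => norm_add_le _ _).trans ?_
      rw [Finset.sum_add_distrib]
      exact add_le_add (hC.2 x s) (hD.2 x s)
  | smul c f _ hf =>
    obtain ⟨C, hC⟩ := hf
    refine ⟨‖c‖ * C, fun x s => ?_, fun x s => ?_⟩
    · simp only [Pi.smul_apply, norm_smul, ← Finset.mul_sum]
      exact mul_le_mul_of_nonneg_left (hC.1 x s) (norm_nonneg c)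
    · simp only [Pi.smul_apply, norm_smul, ← Finset.mul_sum]
      exact mul_le_mul_of_nonneg_left (hC.2 x s) (norm_nonneg c)

variable [HasOpenBisections X]

/-- The operator `ρₓ(f)` on `ℓ²(𝒢ₓ)`; see `regOp_apply` for the formula. -/
def regOp (f : Cc X) (x : X) : BEll2 (SrcFiber x) :=
  kernelOp (regKernel f.1 x) (exists_fiberBound f.2).choose
    ((exists_fiberBound f.2).choose_spec.rowColBound x)

/-- `(ρₓ(f)ξ)(g) = ∑_{h ∈ 𝒢^{r(g)}} f(h) ξ(h⁻¹g)`. -/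
lemma regOp_apply (f : Cc X) (x : X) (ξ : Ell2 (SrcFiber x)) (g : SrcFiber x) :
    regOp f x ξ g =
      ∑' h : RngFiber g.1, f.1 ⟨h.1, g.1, h.2⟩ * ξ ⟨h.1, g.2 ≫ Groupoid.inv h.2⟩ := by
  rw [regOp, kernelOp_apply, ← (divEquiv g).symm.tsum_eq]
  refine tsum_congr fun h => ?_
  simp [regKernel, divEquiv]

variable (X) in
/-- The C*-algebra `∏ₓ B(ℓ²(𝒢ₓ))` of bounded families of operators, with the norm
`‖(Tₓ)ₓ‖ = supₓ ‖Tₓ‖`. -/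
def RegAmbient : Type _ := CStarProd fun x : X => BEll2 (SrcFiber x)

instance : NonUnitalCStarAlgebra (RegAmbient X) :=
  inferInstanceAs (NonUnitalCStarAlgebra (CStarProd fun x : X => BEll2 (SrcFiber x)))

variable (X) in
/-- The coordinate map `∏ₓ B(ℓ²(𝒢ₓ)) → B(ℓ²(𝒢ₓ))`. -/
def RegAmbient.eval (x : X) : RegAmbient X →⋆ₙₐ[ℂ] BEll2 (SrcFiber x) :=
  CStarProd.eval (fun x : X => BEll2 (SrcFiber x)) x

/-- The family `(ρₓ(f))ₓ`; its norm is the reduced norm `‖f‖ᵣ = supₓ ‖ρₓ(f)‖`. -/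
def regFamily (f : Cc X) : RegAmbient X :=
  CStarProd.mk (fun x => regOp f x) |(exists_fiberBound f.2).choose| fun _ => norm_kernelOp_le _

variable (X) in
/-- The reduced C*-algebra `C*_r(𝒢)`: the completion of the `*`-algebra `C_c(𝒢)` with respect to
the norm `‖f‖ᵣ = supₓ ‖ρₓ(f)‖`, realized as the closed `*`-subalgebra of `∏ₓ B(ℓ²(𝒢ₓ))` generated
by the image of `C_c(𝒢)`. -/
def ReducedCStar : NonUnitalStarSubalgebra ℂ (RegAmbient X) :=
  (NonUnitalStarAlgebra.adjoin ℂ (Set.range (regFamily (X := X)))).topologicalClosure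

/-- The canonical map `C_c(𝒢) → C*_r(𝒢)`. -/
def toReduced (f : Cc X) : ReducedCStar X :=
  ⟨regFamily f, NonUnitalStarSubalgebra.le_topologicalClosure _
    (NonUnitalStarAlgebra.subset_adjoin ℂ _ ⟨f, rfl⟩)⟩

/-- The extension of the representation `ρₓ` to `C*_r(𝒢)`. -/
def rho (x : X) : ReducedCStar X →⋆ₙₐ[ℂ] BEll2 (SrcFiber x) :=
  (RegAmbient.eval X x).comp (NonUnitalStarSubalgebraClass.subtype (ReducedCStar X))

lemma rho_toReduced (f : Cc X) (x : X) : rho x (toReduced f) = regOp f x := rfl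

end Groupoid

end GpdCStar

namespace LeftCancelMonoidGpd

open GpdCStar

section Hull

variable {S : Type*} [Monoid S] [IsLeftCancelMul S]

open scoped Classical in
/-- The left translation `t ↦ st`, as a partial bijection of `S` with domain `S` and range `sS`. -/
def leftTrans (s : S) : S ≃. S where
  toFun t := some (s * t)
  invFun u := if h : ∃ t, s * t = u then some h.choose else none
  inv t u := by
    constructor
    · intro h
      split_ifs at h with hu
      · obtain rfl := Option.some.inj h
        rw [hu.choose_spec]
    · intro h
      obtain rfl := Option.some.inj h
      have hu : ∃ t', s * t' = s * t := ⟨t, rfl⟩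
      rw [dif_pos hu, mul_left_cancel hu.choose_spec]

@[simp] lemma leftTrans_apply (s t : S) : leftTrans s t = some (s * t) := rfl

variable (S) in
/-- Membership in the left inverse hull `I_ℓ(S)`: the inverse semigroup of partial bijections of
`S` generated by the left translations. The product `gh` (first `h`, then `g`) is `h.trans g`. -/
inductive InHull : (S ≃. S) → Prop
  | of (s : S) : InHull (leftTrans s)
  | inv {g : S ≃. S} : InHull g → InHull g.symm
  | mul {g h : S ≃. S} : InHull g → InHull h → InHull (h.trans g)

variable (S) in
/-- The left inverse hull `I_ℓ(S)`. -/
abbrev Hull : Type _ := {g : S ≃. S // InHull S g}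

open scoped Classical in
variable (S) in
/-- A subset `X ⊆ S` is a constructible (right) ideal if the identity map `p_X` of `X` belongs to
`I_ℓ(S)`. The idempotents of `I_ℓ(S)` are exactly the maps `p_X`, so `X ↦ p_X` is the isomorphism
`𝒥(S) ≅ E(S)`. -/
def IsConstructible (X : Set S) : Prop := InHull S (PEquiv.ofSet X)

variable (S) in
/-- The collection `𝒥(S)` of constructible ideals. -/
abbrev CIdeal : Type _ := {X : Set S // IsConstructible S X}

open scoped Classical in
lemma IsConstructible.of_inHull {g : S ≃. S} (hg : InHull S g) (X : Set S)
    (h : ∀ s t, g s = some t ↔ s = t ∧ s ∈ X) : IsConstructible S X := by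
  have : PEquiv.ofSet X = g := by
    ext s t
    simp only [h, PEquiv.ofSet_eq_some_iff]
    constructor
    · rintro ⟨rfl, h⟩; exact ⟨rfl, h⟩
    · rintro ⟨rfl, h⟩; exact ⟨rfl, h⟩
  rw [IsConstructible, this]
  exact hg

open scoped Classical in
/-- The intersection of constructible ideals. -/
def CIdeal.inter (X Y : CIdeal S) : CIdeal S :=
  ⟨X.1 ∩ Y.1, IsConstructible.of_inHull (.mul Y.2 X.2) _ fun s t => by
    simp only [PEquiv.trans_eq_some, PEquiv.ofSet_eq_some_iff, Set.mem_inter_iff]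
    grind⟩

/-- The domain of `g ∈ I_ℓ(S)`; the corresponding idempotent is `g⁻¹g`. -/
def Hull.dom (g : Hull S) : CIdeal S :=
  ⟨{s | ∃ t, g.1 s = some t}, IsConstructible.of_inHull (.mul (.inv g.2) g.2) _ fun s t => by
    simp only [PEquiv.trans_eq_some, PEquiv.eq_some_iff, Set.mem_ofPred_eq]
    constructor
    · rintro ⟨u, h1, h2⟩; exact ⟨g.1.inj h1 h2, u, h1⟩
    · rintro ⟨rfl, u, h⟩; exact ⟨u, h, h⟩⟩

open scoped Classical in
/-- The preimage `g⁻¹(X)`; the corresponding idempotent is `g⁻¹ p_X g`. -/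
def Hull.preim (g : Hull S) (X : CIdeal S) : CIdeal S :=
  ⟨{s | ∃ t ∈ X.1, g.1 s = some t},
    IsConstructible.of_inHull (.mul (.inv g.2) (.mul X.2 g.2)) _ fun s t => by
    simp only [PEquiv.trans_eq_some, PEquiv.eq_some_iff, PEquiv.ofSet_eq_some_iff,
      Set.mem_ofPred_eq]
    constructor
    · rintro ⟨u, ⟨v, h1, rfl, h3⟩, h2⟩; exact ⟨g.1.inj h1 h2, u, h3, h1⟩
    · rintro ⟨rfl, u, hX, h⟩; exact ⟨u, ⟨u, h, rfl, hX⟩, h⟩⟩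

/-- The element `s ∈ S` viewed as an element of `I_ℓ(S)`. -/
def Hull.of (s : S) : Hull S := ⟨leftTrans s, .of s⟩

/-- The inverse in `I_ℓ(S)`. -/
def Hull.inv (g : Hull S) : Hull S := ⟨g.1.symm, .inv g.2⟩

/-- The product `gh` in `I_ℓ(S)`. -/
def Hull.mul (g h : Hull S) : Hull S := ⟨h.1.trans g.1, .mul g.2 h.2⟩

variable (S) in
/-- The collection `𝒥̄(S)` of the sets `X \ (X₁ ∪ ⋯ ∪ Xₘ)` with `X, X₁, …, Xₘ ∈ 𝒥(S)`, `m ≥ 0`. -/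
def IsBarConstructible (Z : Set S) : Prop :=
  ∃ (X : CIdeal S) (F : Set (CIdeal S)), F.Finite ∧ Z = X.1 \ ⋃ Y ∈ F, Y.1

variable (S) in
/-- `S` is C*-regular: whenever `h₁, …, hₙ ∈ I_ℓ(S)` and `X ∈ 𝒥̄(S)` satisfy
`∅ ≠ X ⊆ ⋃ₖ {s : hₖ s = s}`, there are `Y₁, …, Y_l ∈ 𝒥̄(S)` and indices `k₁, …, k_l` with
`X ⊆ ⋃ⱼ Yⱼ` and `h_{kⱼ}|_{Yⱼ} = id` for all `j`. -/
def IsCStarRegular : Prop :=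
  ∀ (n : ℕ) (h : Fin n → Hull S) (X : Set S), IsBarConstructible S X → X.Nonempty →
    (X ⊆ ⋃ k, {s | (h k).1 s = some s}) →
    ∃ (l : ℕ) (Y : Fin l → Set S) (κ : Fin l → Fin n),
      (∀ j, IsBarConstructible S (Y j)) ∧ (X ⊆ ⋃ j, Y j) ∧
      ∀ j, ∀ s ∈ Y j, (h (κ j)).1 s = some s

end Hull

section Spectrum

variable (S : Type*) [Monoid S] [IsLeftCancelMul S]

/-- The space `Ê(S)` of semi-characters of `E(S) ≅ 𝒥(S)`, that is, of nonzero semigroup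
homomorphisms to `{0,1}`, with the topology of pointwise convergence. -/
abbrev SemiChar : Type _ :=
  {χ : CIdeal S → Bool // (∃ X, χ X = true) ∧ ∀ X Y, χ (X.inter Y) = (χ X && χ Y)}

variable {S}

open scoped Classical in
/-- The semi-character `χ_s(p_X) = 𝟙_X(s)`. -/
def pointChar (s : S) : SemiChar S :=
  ⟨fun X => decide (s ∈ X.1),
    ⟨(Hull.of 1).dom, by simp [Hull.dom, Hull.of]⟩, fun X Y => by simp [CIdeal.inter]⟩

variable (S) in
/-- `Ω(S)`, the closure of the orbit `{χ_s : s ∈ S}` of `χ_e` in `Ê(S)`. -/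
def Omega : Type _ := {χ : SemiChar S // χ ∈ closure (Set.range (pointChar (S := S)))}

instance : TopologicalSpace (Omega S) := instTopologicalSpaceSubtype

/-- The value `χ(p_X)` of `χ ∈ Ω(S)`. -/
def Omega.eval (χ : Omega S) (X : CIdeal S) : Bool := χ.1.1 X

instance : CoeFun (Omega S) fun _ => CIdeal S → Bool := ⟨Omega.eval⟩

/-- The point `χ_s ∈ Ω(S)`. -/
def Omega.pt (s : S) : Omega S := ⟨pointChar s, subset_closure ⟨s, rfl⟩⟩

@[ext] lemma Omega.ext {χ ψ : Omega S} (h : ∀ X, χ X = ψ X) : χ = ψ :=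
  Subtype.ext (Subtype.ext (funext h))

lemma Omega.map_inter (χ : Omega S) (X Y : CIdeal S) : χ (X.inter Y) = (χ X && χ Y) :=
  χ.1.2.2 X Y

lemma Omega.pt_eq_true {s : S} {X : CIdeal S} : Omega.pt s X = true ↔ s ∈ X.1 := by
  classical exact decide_eq_true_iff

/-- The extension of `χ ∈ Ω(S)` to `𝒥̄(S)`: `χ(p_Z) = 1` for `Z = X \ (X₁ ∪ ⋯ ∪ Xₘ)` if
`χ(p_X) = 1` and `χ(p_{Xᵢ}) = 0` for all `i`. -/
def Omega.BarOne (χ : Omega S) (Z : Set S) : Prop :=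
  ∃ (X : CIdeal S) (F : Set (CIdeal S)), F.Finite ∧ Z = X.1 \ ⋃ Y ∈ F, Y.1 ∧
    χ X = true ∧ ∀ Y ∈ F, χ Y = false

lemma Omega.BarOne.inter {χ : Omega S} {Z W : Set S} (hZ : χ.BarOne Z) (hW : χ.BarOne W) :
    χ.BarOne (Z ∩ W) := by
  obtain ⟨X, F, hF, rfl, hX, hF0⟩ := hZ
  obtain ⟨Y, G, hG, rfl, hY, hG0⟩ := hW
  refine ⟨X.inter Y, F ∪ G, hF.union hG, ?_, ?_, ?_⟩
  · ext s
    simp only [CIdeal.inter, Set.mem_inter_iff, Set.mem_sdiff, Set.mem_iUnion, Set.mem_union]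
    grind
  · rw [χ.map_inter, hX, hY]; rfl
  · rintro Y (h | h)
    · exact hF0 Y h
    · exact hG0 Y h

lemma Omega.barOne_of {χ : Omega S} {X : CIdeal S} (h : χ X = true) : χ.BarOne X.1 :=
  ⟨X, ∅, Set.finite_empty, by simp, h, by simp⟩

end Spectrum
section Germs

variable {S : Type*} [Monoid S] [IsLeftCancelMul S]

lemma continuous_eval (X : CIdeal S) : Continuous fun χ : SemiChar S => χ.1 X :=
  (continuous_apply X).comp continuous_subtype_val

lemma act_mem_closure (g : Hull S) (χ : Omega S) (h : χ g.dom = true)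
    (h' : (∃ X, χ (g.preim X) = true) ∧
      ∀ X Y, χ (g.preim (X.inter Y)) = (χ (g.preim X) && χ (g.preim Y))) :
    (⟨fun X => χ (g.preim X), h'⟩ : SemiChar S) ∈ closure (Set.range (pointChar (S := S))) := by
  rw [closure_subtype]
  have hU : IsOpen {ψ : SemiChar S | ψ.1 g.dom = true} :=
    (isOpen_discrete {true}).preimage (continuous_eval g.dom)
  have h1 : χ.1 ∈ closure (Set.range (pointChar (S := S)) ∩ {ψ : SemiChar S | ψ.1 g.dom = true}) := by
    rw [Set.inter_comm]
    exact hU.inter_closure ⟨h, χ.2⟩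
  have hc : Continuous fun ψ : SemiChar S => (fun X => ψ.1 (g.preim X) : CIdeal S → Bool) :=
    continuous_pi fun X => continuous_eval _
  refine map_mem_closure (f := fun ψ : SemiChar S => (fun X => ψ.1 (g.preim X) : CIdeal S → Bool))
    hc h1 ?_
  rintro _ ⟨⟨s, rfl⟩, hs⟩
  obtain ⟨t, ht⟩ : s ∈ g.dom.1 := by
    classical exact decide_eq_true_iff.1 hs
  refine ⟨pointChar t, ⟨t, rfl⟩, ?_⟩
  funext X
  simp only [pointChar, Hull.preim]
  congr 1
  simp [ht]

/-- The action `χ ↦ χ(g⁻¹ · g)` of `g ∈ I_ℓ(S)` on the `χ ∈ Ω(S)` with `χ(g⁻¹g) = 1`. -/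
def Omega.act (g : Hull S) (χ : Omega S) (h : χ g.dom = true) : Omega S :=
  have h' : (∃ X, χ (g.preim X) = true) ∧
      ∀ X Y, χ (g.preim (X.inter Y)) = (χ (g.preim X) && χ (g.preim Y)) := by
    refine ⟨⟨(Hull.of 1).dom, ?_⟩, fun X Y => ?_⟩
    · rw [← h]
      congr 1
      ext s
      simp [Hull.preim, Hull.dom, Hull.of]
    · rw [← χ.map_inter]
      congr 1
      ext s
      simp only [Hull.preim, CIdeal.inter, Set.mem_ofPred_eq, Set.mem_inter_iff]
      grind
  ⟨⟨fun X => χ (g.preim X), h'⟩, act_mem_closure g χ h h'⟩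

lemma Omega.act_apply (g : Hull S) (χ : Omega S) (h : χ g.dom = true) (X : CIdeal S) :
    χ.act g h X = χ (g.preim X) := rfl

/-- The elements `g ∈ I_ℓ(S)` with `χ(g⁻¹g) = 1`. -/
abbrev Hull.At (χ : Omega S) : Type _ := {g : Hull S // χ g.dom = true}

/-- `(g, χ) ∼ (h, χ)` if `g` and `h` coincide on some `Z ∈ 𝒥̄(S)` with `χ(p_Z) = 1`. -/
def germRel (χ : Omega S) (g h : Hull.At χ) : Prop :=
  ∃ Z, χ.BarOne Z ∧ ∀ s ∈ Z, g.1.1 s = h.1.1 s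

/-- The equivalence relation `∼` on the pairs `(g, χ)` with fixed `χ`. -/
def germSetoid (χ : Omega S) : Setoid (Hull.At χ) where
  r := germRel χ
  iseqv :=
    { refl := fun g => ⟨_, Omega.barOne_of g.2, fun _ _ => rfl⟩
      symm := fun ⟨Z, hZ, h⟩ => ⟨Z, hZ, fun s hs => (h s hs).symm⟩
      trans := fun ⟨_, hZ, h⟩ ⟨_, hW, h'⟩ =>
        ⟨_, hZ.inter hW, fun s hs => (h s hs.1).trans (h' s hs.2)⟩ }

/-- The classes `[g, χ]` with fixed `χ`. -/
abbrev Germ (χ : Omega S) : Type _ := Quotient (germSetoid χ)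

/-- The class `[g, χ]`. -/
def Germ.mk {χ : Omega S} (g : Hull S) (hg : χ g.dom = true) : Germ χ :=
  Quotient.mk (germSetoid χ) ⟨g, hg⟩

lemma Germ.mk_eq {χ : Omega S} {g h : Hull S} {hg : χ g.dom = true} {hh : χ h.dom = true} :
    Germ.mk g hg = Germ.mk h hh ↔ ∃ Z, χ.BarOne Z ∧ ∀ s ∈ Z, g.1 s = h.1 s :=
  ⟨fun h => Quotient.exact h, fun h => Quotient.sound h⟩

lemma Omega.exists_pt (χ : Omega S) {F : Set (CIdeal S)} (hF : F.Finite) :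
    ∃ s, ∀ X ∈ F, χ X = Omega.pt s X := by
  have hU : IsOpen {ψ : SemiChar S | ∀ X ∈ F, ψ.1 X = χ X} := by
    have : {ψ : SemiChar S | ∀ X ∈ F, ψ.1 X = χ X} =
        ⋂ X ∈ F, {ψ : SemiChar S | ψ.1 X = χ X} := by ext; simp
    rw [this]
    exact hF.isOpen_biInter fun X _ => (isOpen_discrete {χ X}).preimage (continuous_eval X)
  obtain ⟨_, h, s, rfl⟩ := mem_closure_iff.1 χ.2 _ hU fun _ _ => rfl
  exact ⟨s, fun X hX => (h X hX).symm⟩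

lemma germRel.act_eq {χ : Omega S} {g h : Hull.At χ} (hgh : germRel χ g h) :
    χ.act g.1 g.2 = χ.act h.1 h.2 := by
  obtain ⟨_, ⟨X, F, hF, rfl, hX, hF0⟩, H⟩ := hgh
  ext Y
  simp only [Omega.act_apply]
  obtain ⟨s, hs⟩ := χ.exists_pt (F := F ∪ {X, g.1.preim Y, h.1.preim Y}) (hF.union (by simp))
  have h1 : s ∈ X.1 := Omega.pt_eq_true.1 (by rw [← hs X (by simp), hX])
  have h2 : ∀ Z ∈ F, s ∉ Z.1 := fun Z hZ hsZ => by
    have := hs Z (Or.inl hZ)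
    rw [hF0 Z hZ, Omega.pt_eq_true.2 hsZ] at this
    exact absurd this (by simp)
  have h3 := H s ⟨h1, by simpa using h2⟩
  rw [hs (g.1.preim Y) (by simp), hs (h.1.preim Y) (by simp), Bool.eq_iff_iff,
    Omega.pt_eq_true, Omega.pt_eq_true]
  simp [Hull.preim, h3]

/-- The range `χ(g⁻¹ · g)` of `[g, χ]`. -/
def Germ.rng {χ : Omega S} (γ : Germ χ) : Omega S :=
  Quotient.lift (fun g : Hull.At χ => χ.act g.1 g.2) (fun _ _ h => germRel.act_eq h) γ

lemma Omega.BarOne.preim {χ : Omega S} {g : Hull S} (hg : χ g.dom = true) {Z : Set S}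
    (hZ : (χ.act g hg).BarOne Z) : χ.BarOne {s | ∃ t ∈ Z, g.1 s = some t} := by
  obtain ⟨X, F, hF, rfl, hX, hF0⟩ := hZ
  refine ⟨g.preim X, g.preim '' F, hF.image _, ?_, hX, ?_⟩
  · ext s
    simp only [Hull.preim, Set.mem_sdiff, Set.mem_iUnion, Set.mem_ofPred_eq, Set.mem_image,
      Set.biUnion_image]
    constructor
    · rintro ⟨t, ⟨hX, hF⟩, h⟩
      refine ⟨⟨t, hX, h⟩, ?_⟩
      rintro ⟨Y, hY, u, hu, h'⟩
      obtain rfl : t = u := Option.some.inj (h.symm.trans h')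
      exact hF ⟨Y, hY, hu⟩
    · rintro ⟨⟨t, hX, h⟩, hF⟩
      exact ⟨t, ⟨hX, fun ⟨Y, hY, hu⟩ => hF ⟨Y, hY, t, hu, h⟩⟩, h⟩
  · rintro _ ⟨Y, hY, rfl⟩
    exact hF0 Y hY

lemma Hull.dom_mul {χ : Omega S} {g h : Hull S} (hg : χ g.dom = true)
    (hh : χ.act g hg h.dom = true) : χ (h.mul g).dom = true := by
  rw [Omega.act_apply] at hh
  rw [← hh]
  congr 1
  ext s
  simp only [Hull.dom, Hull.preim, Hull.mul, Set.mem_ofPred_eq, PEquiv.trans_eq_some]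
  grind

lemma Omega.act_mul {χ : Omega S} {g h : Hull S} (hg : χ g.dom = true)
    (hh : χ.act g hg h.dom = true) :
    χ.act (h.mul g) (Hull.dom_mul hg hh) = (χ.act g hg).act h hh := by
  ext X
  simp only [Omega.act_apply]
  congr 1
  ext s
  simp only [Hull.preim, Hull.mul, Set.mem_ofPred_eq, PEquiv.trans_eq_some]
  grind

lemma Hull.dom_inv {χ : Omega S} {g : Hull S} (hg : χ g.dom = true) :
    χ.act g hg g.inv.dom = true := by
  rw [Omega.act_apply, ← hg]
  congr 1
  ext s
  simp only [Hull.preim, Hull.dom, Hull.inv, Set.mem_ofPred_eq, PEquiv.eq_some_iff]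
  grind

lemma Omega.act_inv {χ : Omega S} {g : Hull S} (hg : χ g.dom = true) :
    (χ.act g hg).act g.inv (Hull.dom_inv hg) = χ := by
  ext X
  simp only [Omega.act_apply]
  have : g.preim (g.inv.preim X) = X.inter g.dom := by
    ext s
    simp only [Hull.preim, Hull.dom, Hull.inv, CIdeal.inter, Set.mem_ofPred_eq,
      PEquiv.eq_some_iff, Set.mem_inter_iff]
    constructor
    · rintro ⟨t, ⟨u, hu, h1⟩, h2⟩
      obtain rfl := g.1.inj h1 h2
      exact ⟨hu, t, h2⟩
    · rintro ⟨hX, t, ht⟩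
      exact ⟨t, ⟨s, hX, ht⟩, ht⟩
  rw [this, χ.map_inter, hg, Bool.and_true]

lemma Omega.dom_one (χ : Omega S) : χ (Hull.of (1 : S)).dom = true := by
  obtain ⟨X, hX⟩ := χ.1.2.1
  have h := χ.map_inter X (Hull.of (1 : S)).dom
  have h2 : X.inter (Hull.of (1 : S)).dom = X := by
    ext s
    simp [CIdeal.inter, Hull.dom, Hull.of]
  rw [h2, show χ X = true from hX] at h
  simpa using h.symm

lemma Omega.act_one (χ : Omega S) : χ.act (Hull.of 1) χ.dom_one = χ := by
  ext X
  rw [Omega.act_apply]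
  congr 1
  ext s
  simp [Hull.preim, Hull.of]

/-- The arrows of `𝒢(S)` from `χ` to `ψ`: the classes `[g, χ]` with `χ(g⁻¹ · g) = ψ`. -/
abbrev GHom (χ ψ : Omega S) : Type _ := {γ : Germ χ // γ.rng = ψ}

/-- The arrow `[g, χ]`. -/
def GHom.mk {χ ψ : Omega S} (g : Hull S) (hg : χ g.dom = true) (h : χ.act g hg = ψ) : GHom χ ψ :=
  ⟨Germ.mk g hg, h⟩

lemma GHom.ind {χ ψ : Omega S} {P : GHom χ ψ → Prop} (h : ∀ g hg h, P (GHom.mk g hg h))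
    (γ : GHom χ ψ) : P γ := by
  obtain ⟨γ, hγ⟩ := γ
  induction γ using Quotient.inductionOn with
  | h g => exact h g.1 g.2 hγ

lemma GHom.exists_mk {χ ψ : Omega S} (γ : GHom χ ψ) :
    ∃ (g : Hull S) (hg : χ g.dom = true) (h : χ.act g hg = ψ), γ = GHom.mk g hg h :=
  ⟨γ.1.out.1, γ.1.out.2, by
    have h : Germ.rng (χ := χ) (Quotient.mk (germSetoid χ) (Quotient.out γ.1)) = ψ := by
      rw [Quotient.out_eq]; exact γ.2
    exact h, Subtype.ext (Quotient.out_eq γ.1).symm⟩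

lemma GHom.mk_eq {χ ψ : Omega S} {g h : Hull S} {hg : χ g.dom = true} {hh : χ h.dom = true}
    {hg' : χ.act g hg = ψ} {hh' : χ.act h hh = ψ} :
    GHom.mk g hg hg' = GHom.mk h hh hh' ↔ ∃ Z, χ.BarOne Z ∧ ∀ s ∈ Z, g.1 s = h.1 s :=
  Subtype.ext_iff.trans Germ.mk_eq

/-- A representative `g` of the arrow `[g, χ]`. -/
def GHom.rep {χ ψ : Omega S} (γ : GHom χ ψ) : Hull S := (Quotient.out γ.1).1

lemma GHom.rep_dom {χ ψ : Omega S} (γ : GHom χ ψ) : χ γ.rep.dom = true := (Quotient.out γ.1).2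

lemma GHom.rep_act {χ ψ : Omega S} (γ : GHom χ ψ) : χ.act γ.rep γ.rep_dom = ψ := by
  have h : Germ.rng (χ := χ) (Quotient.mk (germSetoid χ) (Quotient.out γ.1)) = ψ := by
    rw [Quotient.out_eq]; exact γ.2
  exact h

lemma GHom.mk_rep {χ ψ : Omega S} (γ : GHom χ ψ) : GHom.mk γ.rep γ.rep_dom γ.rep_act = γ :=
  Subtype.ext (Quotient.out_eq γ.1)

lemma GHom.rep_mk {χ ψ : Omega S} (g : Hull S) (hg : χ g.dom = true) (h : χ.act g hg = ψ) :
    ∃ Z, χ.BarOne Z ∧ ∀ s ∈ Z, (GHom.mk g hg h).rep.1 s = g.1 s :=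
  GHom.mk_eq.1 (GHom.mk_rep (GHom.mk g hg h))

lemma GHom.comp_dom {χ ψ : Omega S} {g h : Hull S} (hg : χ g.dom = true) (hg' : χ.act g hg = ψ)
    (hh : ψ h.dom = true) : χ (h.mul g).dom = true := by
  subst hg'; exact Hull.dom_mul hg hh

lemma GHom.comp_act {χ ψ η : Omega S} {g h : Hull S} (hg : χ g.dom = true) (hg' : χ.act g hg = ψ)
    (hh : ψ h.dom = true) (hh' : ψ.act h hh = η) :
    χ.act (h.mul g) (GHom.comp_dom hg hg' hh) = η := by
  subst hg'; subst hh'; exact Omega.act_mul hg hh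

/-- The product `[h, ψ][g, χ] = [hg, χ]`, where `ψ = χ(g⁻¹ · g)`. It is defined using chosen
representatives and is independent of the choice by `GHom.comp_mk`. -/
def GHom.comp {χ ψ η : Omega S} (γ : GHom χ ψ) (δ : GHom ψ η) : GHom χ η :=
  GHom.mk (δ.rep.mul γ.rep) (GHom.comp_dom γ.rep_dom γ.rep_act δ.rep_dom)
    (GHom.comp_act γ.rep_dom γ.rep_act δ.rep_dom δ.rep_act)

lemma GHom.comp_mk {χ ψ η : Omega S} {g h : Hull S} (hg : χ g.dom = true) (hg' : χ.act g hg = ψ)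
    (hh : ψ h.dom = true) (hh' : ψ.act h hh = η) :
    (GHom.mk g hg hg').comp (GHom.mk h hh hh') =
      GHom.mk (h.mul g) (GHom.comp_dom hg hg' hh) (GHom.comp_act hg hg' hh hh') := by
  refine GHom.mk_eq.2 ?_
  obtain ⟨Z, hZ, hZ'⟩ := GHom.rep_mk g hg hg'
  obtain ⟨W, hW, hW'⟩ := GHom.rep_mk h hh hh'
  subst hg'
  refine ⟨_, hZ.inter (hW.preim hg), ?_⟩
  rintro s ⟨hs, t, ht, hst⟩
  change ((GHom.mk g hg rfl).rep.1.trans _) s = (g.1.trans h.1) s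
  change Option.bind _ _ = Option.bind _ _
  rw [show (GHom.mk g hg rfl).rep.1 s = g.1 s from hZ' s hs, hst]
  exact hW' t ht

lemma GHom.inv_dom {χ ψ : Omega S} {g : Hull S} (hg : χ g.dom = true) (hg' : χ.act g hg = ψ) :
    ψ g.inv.dom = true := by
  subst hg'; exact Hull.dom_inv hg

lemma GHom.inv_act {χ ψ : Omega S} {g : Hull S} (hg : χ g.dom = true) (hg' : χ.act g hg = ψ) :
    ψ.act g.inv (GHom.inv_dom hg hg') = χ := by
  subst hg'; exact Omega.act_inv hg

/-- The inverse `[g, χ]⁻¹ = [g⁻¹, χ(g⁻¹ · g)]`. -/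
def GHom.inv {χ ψ : Omega S} (γ : GHom χ ψ) : GHom ψ χ :=
  GHom.mk γ.rep.inv (GHom.inv_dom γ.rep_dom γ.rep_act) (GHom.inv_act γ.rep_dom γ.rep_act)

/-- The groupoid `𝒢(S)` with unit space `Ω(S)`. (In `γ ≫ δ` the arrow `γ` comes first, so this is
the product `δγ`.) -/
instance : Groupoid (Omega S) where
  Hom := GHom
  id χ := GHom.mk (Hull.of 1) χ.dom_one χ.act_one
  comp := GHom.comp
  inv := GHom.inv
  id_comp γ := by
    induction γ using GHom.ind with
    | h g hg h =>
      rw [GHom.comp_mk, GHom.mk_eq]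
      exact ⟨_, Omega.barOne_of hg, fun s _ => by simp [Hull.mul, Hull.of, PEquiv.trans]⟩
  comp_id γ := by
    induction γ using GHom.ind with
    | h g hg h =>
      rw [GHom.comp_mk, GHom.mk_eq]
      refine ⟨_, Omega.barOne_of hg, ?_⟩
      rintro s ⟨t, ht⟩
      simp [Hull.mul, Hull.of, PEquiv.trans, ht]
  assoc γ δ ε := by
    induction γ using GHom.ind with
    | h g hg h =>
    induction δ using GHom.ind with
    | h g' hg' h' =>
    induction ε using GHom.ind with
    | h g'' hg'' h'' =>
      simp only [GHom.comp_mk]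
      rw [GHom.mk_eq]
      exact ⟨_, Omega.barOne_of hg, fun s _ => by simp [Hull.mul, PEquiv.trans_assoc]⟩
  inv_comp {χ ψ} γ := by
    suffices h : GHom.comp γ.inv (GHom.mk γ.rep γ.rep_dom γ.rep_act) =
        GHom.mk (Hull.of 1) ψ.dom_one ψ.act_one by rwa [GHom.mk_rep] at h
    rw [GHom.inv, GHom.comp_mk, GHom.mk_eq]
    refine ⟨_, Omega.barOne_of (GHom.inv_dom γ.rep_dom γ.rep_act), fun s => ?_⟩
    rintro ⟨t, ht⟩
    have ht' := ht
    simp only [Hull.inv, PEquiv.eq_some_iff] at ht'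
    simp only [Hull.mul, Hull.of, leftTrans_apply, one_mul, PEquiv.trans_eq_some]
    exact ⟨t, ht, ht'⟩
  comp_inv {χ ψ} γ := by
    suffices h : GHom.comp (GHom.mk γ.rep γ.rep_dom γ.rep_act) γ.inv =
        GHom.mk (Hull.of 1) χ.dom_one χ.act_one by rwa [GHom.mk_rep] at h
    rw [GHom.inv, GHom.comp_mk, GHom.mk_eq]
    refine ⟨_, Omega.barOne_of γ.rep_dom, fun s => ?_⟩
    rintro ⟨t, ht⟩
    simp only [Hull.mul, Hull.of, Hull.inv, leftTrans_apply, one_mul, PEquiv.trans_eq_some,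
      PEquiv.eq_some_iff]
    exact ⟨t, ht, ht⟩

end Germs

section Topology

variable {S : Type*} [Monoid S] [IsLeftCancelMul S]

/-- The arrow `[g, χ]`, as an element of the set of arrows of `𝒢(S)`. -/
def germArr (g : Hull S) (χ : Omega S) (h : χ g.dom = true) : Arr (Omega S) :=
  ⟨χ, χ.act g h, GHom.mk g h rfl⟩

/-- The set `D(g, U) = {[g, χ] : χ ∈ U}`, where only the `χ` with `χ(g⁻¹g) = 1` contribute. -/
def D (g : Hull S) (U : Set (Omega S)) : Set (Arr (Omega S)) :=
  {γ | ∃ (χ : Omega S) (h : χ g.dom = true), χ ∈ U ∧ γ = germArr g χ h}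

/-- The topology on `𝒢(S)`: the sets `D(g, U)`, where `g ∈ I_ℓ(S)` and `U` is an open subset of
`{χ ∈ Ω(S) : χ(g⁻¹g) = 1}`, form a basis. -/
instance : TopologicalSpace (Arr (Omega S)) :=
  TopologicalSpace.generateFrom
    {W | ∃ (g : Hull S) (U : Set (Omega S)), IsOpen U ∧ (∀ χ ∈ U, χ g.dom = true) ∧ W = D g U}

lemma isClopen_eval (X : CIdeal S) : IsClopen {χ : Omega S | χ X = true} :=
  (isClopen_discrete {true}).preimage ((continuous_eval X).comp continuous_subtype_val)

lemma D_inter (g : Hull S) (U : Set (Omega S)) : D g U = D g (U ∩ {χ | χ g.dom = true}) := by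
  ext γ
  constructor
  · rintro ⟨χ, h, hU, rfl⟩; exact ⟨χ, h, ⟨hU, h⟩, rfl⟩
  · rintro ⟨χ, h, hU, rfl⟩; exact ⟨χ, h, hU.1, rfl⟩

lemma isOpen_D (g : Hull S) {U : Set (Omega S)} (hU : IsOpen U) : IsOpen (D g U) := by
  rw [D_inter]
  exact TopologicalSpace.isOpen_generateFrom_of_mem
    ⟨g, _, hU.inter (isClopen_eval g.dom).isOpen, fun _ h => h.2, rfl⟩

lemma exists_germArr (γ : Arr (Omega S)) : ∃ g h, γ = germArr g γ.src h := by
  obtain ⟨χ, ψ, γ⟩ := γ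
  obtain ⟨g, hg, rfl, rfl⟩ := GHom.exists_mk γ
  exact ⟨g, hg, rfl⟩

/-- The arrow `[g, χ]` as the pair of `χ` and the class. -/
def Arr.toSigma (γ : Arr (Omega S)) : Σ χ : Omega S, Germ χ :=
  ⟨γ.src, (show GHom γ.src γ.rng from γ.hom).1⟩

lemma germArr_eq {g h : Hull S} {χ : Omega S} {hg : χ g.dom = true} {hh : χ h.dom = true} :
    germArr g χ hg = germArr h χ hh ↔ ∃ Z, χ.BarOne Z ∧ ∀ s ∈ Z, g.1 s = h.1 s := by
  constructor
  · intro H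
    have H2 := congrArg Arr.toSigma H
    simp only [Arr.toSigma, germArr, Sigma.mk.injEq, heq_eq_eq, true_and] at H2
    exact Germ.mk_eq.1 H2
  · intro H
    have h1 : χ.act g hg = χ.act h hh := germRel.act_eq (g := ⟨g, hg⟩) (h := ⟨h, hh⟩) H
    have h2 : GHom.mk g hg h1 = GHom.mk h hh rfl := GHom.mk_eq.2 H
    have h3 : ∀ (ψ : Omega S) (h : χ.act g hg = ψ),
        germArr g χ hg = (⟨χ, ψ, GHom.mk g hg h⟩ : Arr (Omega S)) := by
      rintro _ rfl; rfl
    rw [h3 _ h1, h2]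
    rfl

lemma act_injective {g : Hull S} {χ ψ : Omega S} {h : χ g.dom = true} {h' : ψ g.dom = true}
    (H : χ.act g h = ψ.act g h') : χ = ψ := by
  have h1 := Omega.act_inv h
  have h2 := Omega.act_inv h'
  rw [← h1, ← h2]
  congr 1

instance : HasOpenBisections (Omega S) where
  exists_bisection γ := by
    obtain ⟨g, h, hγ⟩ := exists_germArr γ
    refine ⟨D g Set.univ, isOpen_D g isOpen_univ, ⟨_, h, trivial, hγ⟩, ?_, ?_⟩
    · rintro _ ⟨χ, h, -, rfl⟩ _ ⟨ψ, h', -, rfl⟩ (H : χ = ψ)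
      subst H; rfl
    · rintro _ ⟨χ, h, -, rfl⟩ _ ⟨ψ, h', -, rfl⟩ H
      obtain rfl : χ = ψ := act_injective (h := h) (h' := h') H
      rfl

instance : T2Space (Omega S) := inferInstanceAs (T2Space (Subtype _))

lemma isClosed_semiChar : IsClosed {χ : CIdeal S → Bool |
    (∃ X, χ X = true) ∧ ∀ X Y, χ (X.inter Y) = (χ X && χ Y)} := by
  have : {χ : CIdeal S → Bool | (∃ X, χ X = true) ∧ ∀ X Y, χ (X.inter Y) = (χ X && χ Y)} =
      {χ | χ (Hull.of (1 : S)).dom = true} ∩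
        ⋂ (X) (Y), {χ : CIdeal S → Bool | χ (X.inter Y) = (χ X && χ Y)} := by
    ext χ
    simp only [Set.mem_ofPred_eq, Set.mem_inter_iff, Set.mem_iInter]
    refine and_congr_left fun h => ⟨?_, fun h => ⟨_, h⟩⟩
    rintro ⟨X, hX⟩
    have h1 := h X (Hull.of (1 : S)).dom
    have h2 : X.inter (Hull.of (1 : S)).dom = X := by
      ext s
      simp [CIdeal.inter, Hull.dom, Hull.of]
    rw [h2, hX] at h1
    simpa using h1.symm
  rw [this]
  refine IsClosed.inter (isClosed_eq (continuous_apply _) continuous_const)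
    (isClosed_iInter fun X => isClosed_iInter fun Y => isClosed_eq (continuous_apply _) ?_)
  exact (continuous_of_discreteTopology (f := fun p : Bool × Bool => (p.1 && p.2))).comp
    (f := fun χ : CIdeal S → Bool => (χ X, χ Y)) ((continuous_apply X).prodMk (continuous_apply Y))

instance : CompactSpace (Omega S) := by
  have : CompactSpace (SemiChar S) := isCompact_iff_compactSpace.1 isClosed_semiChar.isCompact
  exact isCompact_iff_compactSpace.1 isClosed_closure.isCompact

lemma isOpen_barOne (Z : Set S) : IsOpen {χ : Omega S | χ.BarOne Z} := by
  have : {χ : Omega S | χ.BarOne Z} = ⋃ (X : CIdeal S) (F : Set (CIdeal S)) (_ : F.Finite)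
      (_ : Z = X.1 \ ⋃ Y ∈ F, Y.1), {χ | χ X = true} ∩ ⋂ Y ∈ F, {χ : Omega S | χ Y = true}ᶜ := by
    ext χ
    simp only [Omega.BarOne, Set.mem_ofPred_eq, Set.mem_iUnion, Set.mem_inter_iff, Set.mem_iInter,
      Set.mem_compl_iff, Bool.not_eq_true, exists_prop]
  rw [this]
  exact isOpen_iUnion fun X => isOpen_iUnion fun F => isOpen_iUnion fun hF => isOpen_iUnion fun _ =>
    (isClopen_eval X).isOpen.inter
      (hF.isOpen_biInter fun Y _ => (isClopen_eval Y).compl.isOpen)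

lemma continuous_germArr (g : Hull S) :
    Continuous fun χ : {χ : Omega S // χ g.dom = true} => germArr g χ.1 χ.2 := by
  refine continuous_generateFrom_iff.2 ?_
  rintro _ ⟨h, U, hU, -, rfl⟩
  have : (fun χ : {χ : Omega S // χ g.dom = true} => germArr g χ.1 χ.2) ⁻¹' D h U =
      Subtype.val ⁻¹' (U ∩ {χ | χ h.dom = true} ∩
        ⋃ (Z) (_ : ∀ s ∈ Z, g.1 s = h.1 s), {χ : Omega S | χ.BarOne Z}) := by
    ext ⟨χ, hχ⟩
    simp only [Set.mem_preimage, Set.mem_inter_iff, Set.mem_iUnion, Set.mem_ofPred_eq]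
    constructor
    · rintro ⟨ψ, hψ, hU, H⟩
      obtain rfl : χ = ψ := congrArg Arr.src H
      obtain ⟨Z, hZ, H⟩ := germArr_eq.1 H
      exact ⟨⟨hU, hψ⟩, Z, H, hZ⟩
    · rintro ⟨⟨hU, hψ⟩, Z, H, hZ⟩
      exact ⟨χ, hψ, hU, germArr_eq.2 ⟨Z, hZ, H⟩⟩
  rw [this]
  exact ((hU.inter (isClopen_eval _).isOpen).inter
    (isOpen_iUnion fun Z => isOpen_iUnion fun _ => isOpen_barOne Z)).preimage continuous_subtype_val

lemma continuous_src : Continuous (Arr.src : Arr (Omega S) → Omega S) := by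
  refine continuous_def.2 fun U hU => ?_
  have : (Arr.src : Arr (Omega S) → Omega S) ⁻¹' U = ⋃ g : Hull S, D g U := by
    ext γ
    simp only [Set.mem_preimage, Set.mem_iUnion]
    constructor
    · intro h
      obtain ⟨g, hg, H⟩ := exists_germArr γ
      exact ⟨g, γ.src, hg, h, H⟩
    · rintro ⟨g, χ, h, hU, rfl⟩
      exact hU
  rw [this]
  exact isOpen_iUnion fun g => isOpen_D g hU

lemma isBasicCc_indicator (g : Hull S) {U : Set (Omega S)} (hU : IsClopen U) :
    IsBasicCc (Omega S) ((D g U).indicator fun _ => 1) := by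
  refine ⟨D g U, isOpen_D g hU.isOpen, ?_, ?_, D g U, ?_, subset_rfl, ?_⟩
  · refine T2Space.of_injective_continuous (f := fun γ : D g U => γ.1.src) ?_
      (continuous_src.comp continuous_subtype_val)
    rintro ⟨_, χ, h, -, rfl⟩ ⟨_, ψ, h', -, rfl⟩ (H : χ = ψ)
    subst H; rfl
  · refine (continuousOn_const (c := (1 : ℂ))).congr fun γ hγ => ?_
    exact Set.indicator_of_mem hγ _
  · have : D g U = (fun χ : {χ : Omega S // χ g.dom = true} => germArr g χ.1 χ.2) ''
        (Subtype.val ⁻¹' U) := by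
      ext γ
      constructor
      · rintro ⟨χ, h, hU, rfl⟩; exact ⟨⟨χ, h⟩, hU, rfl⟩
      · rintro ⟨⟨χ, h⟩, hU, rfl⟩; exact ⟨χ, h, hU, rfl⟩
    rw [this]
    have hc : CompactSpace {χ : Omega S // χ g.dom = true} :=
      isCompact_iff_compactSpace.1 (isClopen_eval g.dom).isClosed.isCompact
    exact (hU.isClosed.preimage continuous_subtype_val).isCompact.image (continuous_germArr g)
  · exact fun γ hγ => Set.indicator_of_notMem hγ _

/-- The function `𝟙_{D(g, U)} ∈ C_c(𝒢(S))` for a clopen set `U ⊆ Ω(S)`. -/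
def indD (g : Hull S) (U : Set (Omega S)) (hU : IsClopen U) : Cc (Omega S) :=
  ⟨(D g U).indicator fun _ => 1, Submodule.subset_span (isBasicCc_indicator g hU)⟩

end Topology

section Regular

variable {S : Type*} [Monoid S] [IsLeftCancelMul S]

open scoped Classical in
lemma rowColBound_lam (s : S) :
    RowColBound (fun u t : S => if u = s * t then (1 : ℂ) else 0) 1 := by
  refine ⟨fun u F => ?_, fun t F => ?_⟩
  · by_cases h : ∃ t, u = s * t
    · obtain ⟨t, rfl⟩ := h
      simp only [mul_right_inj, apply_ite norm, norm_one, norm_zero]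
      rw [Finset.sum_ite_eq]
      split_ifs <;> simp
    · push Not at h
      simp [h]
  · simp only [apply_ite norm, norm_one, norm_zero]
    rw [Finset.sum_ite_eq']
    split_ifs <;> simp

open scoped Classical in
/-- The operator `λ_s` on `ℓ²(S)`, `λ_s δ_t = δ_{st}`, through its matrix
`(u, t) ↦ 1` if `u = st` and `0` otherwise. -/
def lam (s : S) : BEll2 S := kernelOp _ 1 (rowColBound_lam s)

open scoped Classical in
lemma lam_single (s t : S) :
    lam s (lp.single 2 t (1 : ℂ)) = lp.single 2 (s * t) (1 : ℂ) := by
  ext u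
  rw [lam, kernelOp_apply, tsum_eq_single t]
  · simp [Pi.single_apply]
  · intro v hv
    simp [hv]

variable (S) in
/-- The reduced C*-algebra `C*_r(S)`: the C*-algebra of operators on `ℓ²(S)` generated by the
`λ_s`, `s ∈ S`. -/
def MonoidCStar : NonUnitalStarSubalgebra ℂ (BEll2 S) :=
  (NonUnitalStarAlgebra.adjoin ℂ (Set.range (lam (S := S)))).topologicalClosure

lemma Hull.right_equivariant (g : Hull S) (s t u : S) (h : g.1 s = some u) :
    g.1 (s * t) = some (u * t) := by
  obtain ⟨g, hg⟩ := g
  simp only at h ⊢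
  induction hg generalizing s u with
  | of r =>
    simp only [leftTrans_apply, Option.some.injEq] at h ⊢
    rw [← h, mul_assoc]
  | inv _ ih =>
    rw [PEquiv.eq_some_iff] at h ⊢
    exact ih _ _ h
  | mul _ _ ih1 ih2 =>
    rw [PEquiv.trans_eq_some] at h ⊢
    obtain ⟨v, h1, h2⟩ := h
    exact ⟨v * t, ih2 _ _ h1, ih1 _ _ h2⟩

lemma Hull.dom_of (χ : Omega S) (s : S) : χ (Hull.of s).dom = true := by
  rw [← χ.dom_one]
  congr 1
  ext t
  simp [Hull.dom, Hull.of]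

/-- The arrow `[s, χ_e] ∈ 𝒢(S)_{χ_e}`. -/
def orbitArr (s : S) : SrcFiber (Omega.pt (1 : S)) :=
  ⟨(Omega.pt 1).act (Hull.of s) (Hull.dom_of _ s), GHom.mk (Hull.of s) (Hull.dom_of _ s) rfl⟩

lemma Omega.BarOne.mem_pt {s : S} {Z : Set S} (h : (Omega.pt s).BarOne Z) : s ∈ Z := by
  obtain ⟨X, F, -, rfl, hX, hF⟩ := h
  refine ⟨Omega.pt_eq_true.1 hX, ?_⟩
  simp only [Set.mem_iUnion, not_exists]
  intro Y hY hs
  rw [← Omega.pt_eq_true, hF Y hY] at hs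
  exact absurd hs (by simp)

lemma orbitArr_bijective : Function.Bijective (orbitArr (S := S)) := by
  constructor
  · intro s t h
    have h' : germArr (Hull.of s) (Omega.pt (1 : S)) (Hull.dom_of _ s) =
        germArr (Hull.of t) (Omega.pt (1 : S)) (Hull.dom_of _ t) :=
      congrArg (fun g : SrcFiber (Omega.pt (1 : S)) => (⟨_, g.1, g.2⟩ : Arr (Omega S))) h
    obtain ⟨Z, hZ, H⟩ := germArr_eq.1 h'
    simpa [Hull.of] using H 1 hZ.mem_pt
  · rintro ⟨ψ, γ⟩
    obtain ⟨g, hg, rfl, rfl⟩ := GHom.exists_mk γ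
    obtain ⟨s, hs⟩ : (1 : S) ∈ g.dom.1 := Omega.pt_eq_true.1 hg
    obtain rfl : g = Hull.of s := by
      refine Subtype.ext (PEquiv.ext fun t => ?_)
      have := g.right_equivariant 1 t s hs
      rw [one_mul] at this
      rw [this]
      rfl
    exact ⟨s, rfl⟩

variable (S) in
/-- The bijection `S → 𝒢(S)_{χ_e}`, `s ↦ [s, χ_e]`. -/
def orbitEquiv : S ≃ SrcFiber (Omega.pt (1 : S)) := Equiv.ofBijective orbitArr orbitArr_bijective

variable (S) in
/-- The representation `ρ_{χ_e}` of `C*_r(𝒢(S))`, viewed as a representation on `ℓ²(S)` by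
identifying `S` with `𝒢(S)_{χ_e}` by `s ↦ [s, χ_e]`. -/
def rhoE : ReducedCStar (Omega S) →⋆ₙₐ[ℂ] BEll2 S :=
  NonUnitalStarAlgHom.comp
    ((ell2Congr (orbitEquiv S)).symm.conjStarAlgEquiv : _ →⋆ₙₐ[ℂ] BEll2 S)
    (rho (Omega.pt (1 : S)))

end Regular

section Example

/-- The generators `a, b, c, x_n, y_n` (`n ∈ ℤ`). -/
inductive Gen
  | a | b | c
  | x (n : ℤ)
  | y (n : ℤ)

open FreeMonoid in
/-- The relations `abx_n = bx_n`, `aby_n = by_{n+1}`, `cbx_n = bx_{n+1}`, `cby_n = by_n`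
(`n ∈ ℤ`). -/
inductive TRel : FreeMonoid Gen → FreeMonoid Gen → Prop
  | abx (n : ℤ) : TRel (of .a * of .b * of (.x n)) (of .b * of (.x n))
  | aby (n : ℤ) : TRel (of .a * of .b * of (.y n)) (of .b * of (.y (n + 1)))
  | cbx (n : ℤ) : TRel (of .c * of .b * of (.x n)) (of .b * of (.x (n + 1)))
  | cby (n : ℤ) : TRel (of .c * of .b * of (.y n)) (of .b * of (.y n))

/-- The monoid `T`. -/
abbrev T : Type := PresentedMonoid TRel

/-- The generators, as elements of `T`. -/
abbrev T.gen (g : Gen) : T := PresentedMonoid.of TRel g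

/-- The right ideal `X = ⋃ₙ bx_nT ∪ ⋃ₙ by_nT` of `T`. -/
def T.idealX : Set T :=
  (⋃ n : ℤ, Set.range fun t : T => T.gen .b * T.gen (.x n) * t) ∪
    ⋃ n : ℤ, Set.range fun t : T => T.gen .b * T.gen (.y n) * t

end Example

end LeftCancelMonoidGpd

end

open GpdCStar LeftCancelMonoidGpd

noncomputable section

open CategoryTheory GpdCStar LeftCancelMonoidGpd

/-! On `X` every point is fixed by `a` or by `c`: `a` fixes each `bxₙt` while `c` shifts `n`, and
`c` fixes each `byₙt` while `a` shifts `n`. Moreover `c` preserves the part `⋃ bxₙT` on which `a` is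
the identity. Hence `(λ_a - 1)(λ_c - 1)` kills `δ_t` for every `t ∈ X`, so the element lies in the
kernel of `ρ_{χ_e}` (`rhoE_kernelElement`).

What is fixed pointwise need not be fixed near a limit. Constructible ideals cannot tell the `bxₙ`
and `byₙ` apart up to finitely many of them: each contains all of these elements or only finitely
many (`IsConstructible.bxy_mem_or_finite`). Consequently the points `χ_{bxₙ}` and `χ_{byₙ}`
accumulate at a single character `χ` (`exists_limit_bxy`), and every set of `𝒥̄(T)` on which `χ` is
`1` contains almost all `bxₙ` and almost all `byₙ`. Neither `a` nor `c` is the identity on such a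
set, so `[a, χ]` and `[c, χ]` are both different from the unit `χ`. This refutes C*-regularity,
since one member of any admissible cover of `X` would have to carry `χ`. It also makes the element
nonzero, as its image under `ρ_χ` has a nonzero diagonal coefficient at the unit `χ`.

The dichotomy is combinatorial. Words reduced with respect to the defining relations are normal
forms, and left multiplication by a generator acts on them injectively, which also gives left
cancellation. Left translations and their inverses carry a family `(txₙ, tyₙ)ₙ` to another such
family up to shifts of the indices, or are defined at only finitely many members; this property
passes to all of `I_ℓ(T)`.

That `ρ_{χ_e}` has values in `C*_r(T)` holds for every left cancellative monoid. The matrix of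
`ρ_{χ_e}(f)` is `f` evaluated at `[s, χ_e][t, χ_e]⁻¹`. If `f` is supported in a compact open
bisection `D(g, U)`, this is the matrix of a diagonal operator followed by the partial isometry of
`g`. Stone–Weierstrass puts the diagonal operator in `C*_r(S)`, and a general `f` is cut into
finitely many such pieces. -/

namespace LeftCancelMonoidGpd

/-! ### Normal forms in `T` and left cancellation -/

section NormalForm

/-- Left multiplication by a generator on the normal forms of the elements of `T`: the words without
subwords `abxₙ`, `abyₙ`, `cbxₙ`, `cbyₙ`. -/
def Gen.act : Gen → List Gen → List Gen
  | .a, .b :: .x n :: w => .b :: .x n :: w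
  | .a, .b :: .y n :: w => .b :: .y (n + 1) :: w
  | .c, .b :: .x n :: w => .b :: .x (n + 1) :: w
  | .c, .b :: .y n :: w => .b :: .y n :: w
  | g, w => g :: w

/-- The first letter of the result shows whether a rewriting rule was applied (`b` instead of `a` or
`c`), and each rule acts on the index by a bijection of `ℤ`. -/
lemma Gen.act_injective (g : Gen) : Function.Injective g.act := by
  intro v w h
  unfold Gen.act at h
  split at h <;> split at h <;> grind

lemma Gen.act_eq_singleton {g h : Gen} {w : List Gen} (H : g.act w = [h]) : g = h := by
  unfold Gen.act at H
  split at H <;> simp_all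

lemma Gen.exists_of_act_c_eq_act_a {v w : List Gen} (H : Gen.c.act v = Gen.a.act w) :
    ∃ n u, Gen.a.act w = .b :: .x n :: u ∨ Gen.a.act w = .b :: .y n :: u := by
  unfold Gen.act at H ⊢
  split at H <;> split at H <;> simp_all

/-- The action of `T` on words extending `Gen.act`. -/
def T.actHom : T →* Function.End (List Gen) :=
  PresentedMonoid.lift (M := Function.End (List Gen)) Gen.act (by
    intro u v h
    -- Both sides of a relation prepend the same two letters to any word, reduced or not, so no
    -- restriction to normal forms is needed.
    cases h <;> rfl)

/-- The normal form of an element of `T`. -/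
def T.nf (t : T) : List Gen := T.actHom t []

/-- The element of `T` defined by a word. -/
def T.ofWord (w : List Gen) : T := (w.map T.gen).prod

lemma T.ofWord_cons (g : Gen) (w : List Gen) : T.ofWord (g :: w) = T.gen g * T.ofWord w := by
  simp [T.ofWord]

lemma T.abx (n : ℤ) : T.gen .a * (T.gen .b * T.gen (.x n)) = T.gen .b * T.gen (.x n) := by
  rw [← mul_assoc]
  exact PresentedMonoid.mk_eq_mk_of_rel (.abx n)

lemma T.aby (n : ℤ) : T.gen .a * (T.gen .b * T.gen (.y n)) = T.gen .b * T.gen (.y (n + 1)) := by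
  rw [← mul_assoc]
  exact PresentedMonoid.mk_eq_mk_of_rel (.aby n)

lemma T.cbx (n : ℤ) : T.gen .c * (T.gen .b * T.gen (.x n)) = T.gen .b * T.gen (.x (n + 1)) := by
  rw [← mul_assoc]
  exact PresentedMonoid.mk_eq_mk_of_rel (.cbx n)

lemma T.cby (n : ℤ) : T.gen .c * (T.gen .b * T.gen (.y n)) = T.gen .b * T.gen (.y n) := by
  rw [← mul_assoc]
  exact PresentedMonoid.mk_eq_mk_of_rel (.cby n)

lemma T.ofWord_act (g : Gen) (w : List Gen) : T.ofWord (g.act w) = T.gen g * T.ofWord w := by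
  unfold Gen.act
  split
  · simp only [T.ofWord_cons, ← mul_assoc]
    rw [mul_assoc (T.gen .a), T.abx]
  · simp only [T.ofWord_cons, ← mul_assoc]
    rw [mul_assoc (T.gen .a), T.aby]
  · simp only [T.ofWord_cons, ← mul_assoc]
    rw [mul_assoc (T.gen .c), T.cbx]
  · simp only [T.ofWord_cons, ← mul_assoc]
    rw [mul_assoc (T.gen .c), T.cby]
  · exact T.ofWord_cons _ _

lemma T.nf_gen_mul (g : Gen) (t : T) : T.nf (T.gen g * t) = g.act (T.nf t) := by
  simp only [T.nf, map_mul]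
  rfl

lemma T.induction {P : T → Prop} (one : P 1) (mul : ∀ g t, P t → P (T.gen g * t)) (t : T) : P t := by
  induction t using PresentedMonoid.inductionOn with
  | h w =>
    induction w using FreeMonoid.inductionOn' with
    | one => exact one
    | of_mul g w ih =>
      rw [map_mul]
      exact mul g _ ih

lemma T.nf_one : T.nf 1 = [] := by
  simp only [T.nf, map_one]
  rfl

lemma T.ofWord_nf (t : T) : T.ofWord (T.nf t) = t := by
  induction t using T.induction with
  | one => rw [T.nf_one]; rfl
  | mul g t ih => rw [T.nf_gen_mul, T.ofWord_act, ih]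

lemma T.nf_injective : Function.Injective T.nf :=
  Function.LeftInverse.injective T.ofWord_nf

lemma T.isLeftCancelMul : IsLeftCancelMul T where
  mul_left_cancel s := by
    induction s using T.induction with
    | one => intro t u h; simpa using h
    | mul g s ih =>
      intro t u (h : T.gen g * s * t = T.gen g * s * u)
      refine ih (T.nf_injective (g.act_injective ?_))
      rw [mul_assoc, mul_assoc] at h
      simpa only [T.nf_gen_mul] using congrArg T.nf h

/-- By injectivity of `g.act`, a word which `g.act` sends to a normal form is itself a normal form.
Thus divisibility by `g` on the left can be read off from the range of `g.act`. -/
lemma T.nf_ofWord_of_act {g : Gen} {w : List Gen} {t : T} (h : T.nf t = g.act w) :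
    T.gen g * T.ofWord w = t ∧ T.nf (T.ofWord w) = w := by
  have h1 : T.gen g * T.ofWord w = t := by rw [← T.ofWord_act, ← h, T.ofWord_nf]
  refine ⟨h1, g.act_injective ?_⟩
  rw [← T.nf_gen_mul, h1, h]

/-- This is `X = aT ∩ cT`, from which constructibility is immediate. A normal form in the ranges of
both `a` and `c` cannot begin with either letter, so a rule was applied and it begins with `bxₙ` or
`byₙ`. -/
lemma T.mem_idealX_iff {t : T} : t ∈ T.idealX ↔
    (∃ u, T.gen .a * u = t) ∧ ∃ u, T.gen .c * u = t := by
  constructor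
  · rintro (h | h) <;> obtain ⟨n, u, rfl⟩ := Set.mem_iUnion.1 h
    · refine ⟨⟨_, by rw [← mul_assoc, T.abx]⟩,
        ⟨T.gen .b * T.gen (.x (n - 1)) * u, ?_⟩⟩
      rw [← mul_assoc, T.cbx, sub_add_cancel]
    · refine ⟨⟨T.gen .b * T.gen (.y (n - 1)) * u, ?_⟩, ⟨_, by rw [← mul_assoc, T.cby]⟩⟩
      rw [← mul_assoc, T.aby, sub_add_cancel]
  · rintro ⟨⟨u, rfl⟩, v, h⟩
    have h1 := congrArg T.nf h
    rw [T.nf_gen_mul, T.nf_gen_mul] at h1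
    rw [← T.ofWord_nf (T.gen .a * u), T.nf_gen_mul]
    obtain ⟨n, w, H | H⟩ := Gen.exists_of_act_c_eq_act_a h1
    · refine Or.inl (Set.mem_iUnion.2 ⟨n, T.ofWord w, ?_⟩)
      simp only [H, T.ofWord_cons, mul_assoc]
    · refine Or.inr (Set.mem_iUnion.2 ⟨n, T.ofWord w, ?_⟩)
      simp only [H, T.ofWord_cons, mul_assoc]

end NormalForm

/-! ### Families indexed by `ℤ ⊕ ℤ` and constructible ideals -/

section Families

attribute [local instance] T.isLeftCancelMul

/-- The letters `xₙ` and `yₙ`, with the indices shifted by `i` and `j`. -/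
def shiftLetter (i j : ℤ) : ℤ ⊕ ℤ → Gen
  | .inl n => .x (n + i)
  | .inr n => .y (n + j)

lemma shiftLetter_injective (i j : ℤ) : Function.Injective (shiftLetter i j) := by
  rintro (m | m) (n | n) h <;> simp_all [shiftLetter]

/-- A rule inspects only the first two letters of the word acted upon, so an appended letter matters
only if it completes `b` to `bxₙ` or `byₙ` under `a` or `c`. -/
lemma Gen.act_append (g : Gen) (w : List Gen) (s : Gen) (h : w = [.b] → g ≠ .a ∧ g ≠ .c) :
    g.act (w ++ [s]) = g.act w ++ [s] := by
  match w with
  | [] => cases g <;> cases s <;> rfl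
  | [k] => cases g <;> cases k <;> simp_all [Gen.act]
  | k :: l :: w => cases g <;> cases k <;> cases l <;> rfl

/-- In the exceptional case `w = [b]`, the letter `a` shifts only the indices of the `yₙ` and `c`
only those of the `xₙ`; this is why families carry two independent shifts. -/
lemma Gen.act_append_shiftLetter (g : Gen) (w : List Gen) (i j : ℤ) :
    ∃ w' i' j', ∀ z, g.act (w ++ [shiftLetter i j z]) = w' ++ [shiftLetter i' j' z] := by
  by_cases h : w = [.b] → g ≠ .a ∧ g ≠ .c
  · exact ⟨g.act w, i, j, fun z => g.act_append w _ h⟩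
  · obtain ⟨rfl, h⟩ := Classical.not_imp.1 h
    rcases (by tauto : g = .a ∨ g = .c) with rfl | rfl
    · refine ⟨[.b], i, j + 1, ?_⟩
      rintro (n | n) <;> simp [shiftLetter, Gen.act, add_assoc]
    · refine ⟨[.b], i + 1, j, ?_⟩
      rintro (n | n) <;> simp [shiftLetter, Gen.act, add_assoc]

/-- Apart from the words `[]` and `[b]`, whether `w` followed by a letter lies in the range of
`g.act` is decided by `w` alone. For `[b]` the shift is undone by `a` or `c`, and for `[]` only the
one-letter word `[g]` can occur. -/
lemma Gen.append_shiftLetter_mem_range_act (g : Gen) (w : List Gen) (i j : ℤ) :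
    (∃ w' i' j', ∀ z, g.act (w' ++ [shiftLetter i' j' z]) = w ++ [shiftLetter i j z]) ∨
      {z | w ++ [shiftLetter i j z] ∈ Set.range g.act}.Finite := by
  rcases eq_or_ne w [] with rfl | hw
  · right
    refine Set.Subsingleton.finite ?_
    rintro z ⟨u, hu⟩ z' ⟨u', hu'⟩
    exact shiftLetter_injective i j ((Gen.act_eq_singleton hu).symm.trans (Gen.act_eq_singleton hu'))
  rcases eq_or_ne w [.b] with rfl | hb
  · cases g with
    | a =>
      refine .inl ⟨[.b], i, j - 1, ?_⟩
      rintro (n | n) <;> simp [shiftLetter, Gen.act]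
      ring
    | c =>
      refine .inl ⟨[.b], i - 1, j, ?_⟩
      rintro (n | n) <;> simp [shiftLetter, Gen.act]
      ring
    | b => exact .inl ⟨[], i, j, fun z => rfl⟩
    | x n => right; simp [Gen.act]
    | y n => right; simp [Gen.act]
  by_cases H : ∃ u z, g.act u = w ++ [shiftLetter i j z]
  · obtain ⟨u, z, hu⟩ := H
    left
    rcases u.eq_nil_or_concat' with rfl | ⟨v, s, rfl⟩
    · have := congrArg List.length hu
      have h0 := List.length_pos_iff.2 hw
      have h1 : (g.act []).length = 1 := by cases g <;> rfl
      simp only [List.length_append, List.length_singleton] at this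
      omega
    by_cases h : v = [.b] → g ≠ .a ∧ g ≠ .c
    · rw [g.act_append v _ h] at hu
      have hv := (List.append_inj' hu rfl).1
      exact ⟨v, i, j, fun z' => by rw [g.act_append v _ h, hv]⟩
    -- Here `u = [b, s]` and `g` is `a` or `c`. Either a rule applies and forces `w = [b]`, which is
    -- excluded, or `s` is not one of the `xₙ`, `yₙ` and cannot equal the last letter.
    · exfalso
      obtain ⟨rfl, h⟩ := Classical.not_imp.1 h
      rcases (by tauto : g = .a ∨ g = .c) with rfl | rfl <;> cases s <;> rcases z with z | z <;>
        rcases w with - | ⟨k, - | ⟨l, - | ⟨m, w⟩⟩⟩ <;> simp_all [Gen.act, shiftLetter]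
  · right
    convert Set.finite_empty
    ext z
    simp only [Set.mem_ofPred_eq, Set.mem_range, Set.mem_empty_iff_false, iff_false]
    exact fun ⟨u, hu⟩ => H ⟨u, z, hu⟩

/-- The families `(txₙ, tyₙ)ₙ` in `T` up to shifts of the indices, through their normal forms. -/
def IsFamily (f : ℤ ⊕ ℤ → T) : Prop :=
  ∃ w i j, ∀ z, T.nf (f z) = w ++ [shiftLetter i j z]

/-- A partial map sends every family to a family or is defined on finitely many of its members
only. -/
def RespectsFamilies (g : T → Option T) : Prop :=
  ∀ f, IsFamily f → (∃ f', IsFamily f' ∧ ∀ z, g (f z) = some (f' z)) ∨ {z | (g (f z)).isSome}.Finite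

lemma RespectsFamilies.trans {g h : T ≃. T} (hg : RespectsFamilies g) (hh : RespectsFamilies h) :
    RespectsFamilies (g.trans h) := by
  intro f hf
  have H : ∀ s, (g.trans h) s = (g s).bind h := fun _ => rfl
  obtain ⟨f', hf', h1⟩ | h1 := hg f hf
  · obtain ⟨f'', hf'', h2⟩ | h2 := hh f' hf'
    · exact .inl ⟨f'', hf'', fun z => by rw [H, h1, Option.bind_some, h2]⟩
    · refine .inr (h2.subset fun z hz => ?_)
      simpa [H, h1] using hz
  · refine .inr (h1.subset fun z hz => ?_)
    simp only [H, Set.mem_ofPred_eq] at hz ⊢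
    exact Option.isSome_of_isSome_bind hz

lemma respectsFamilies_leftTrans_gen (g : Gen) : RespectsFamilies (leftTrans (T.gen g)) := by
  rintro f ⟨w, i, j, hf⟩
  obtain ⟨w', i', j', h⟩ := g.act_append_shiftLetter w i j
  exact .inl ⟨fun z => T.gen g * f z, ⟨w', i', j', fun z => by rw [T.nf_gen_mul, hf, h]⟩,
    fun z => rfl⟩

lemma respectsFamilies_symm_leftTrans_gen (g : Gen) :
    RespectsFamilies (leftTrans (T.gen g)).symm := by
  rintro f ⟨w, i, j, hf⟩
  obtain ⟨w', i', j', h⟩ | h := g.append_shiftLetter_mem_range_act w i j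
  · have H := fun z => T.nf_ofWord_of_act ((hf z).trans (h z).symm)
    refine .inl ⟨fun z => T.ofWord (w' ++ [shiftLetter i' j' z]), ⟨w', i', j', fun z => (H z).2⟩,
      fun z => ?_⟩
    rw [PEquiv.eq_some_iff, leftTrans_apply, (H z).1]
  · refine .inr (h.subset fun z hz => ?_)
    obtain ⟨t, ht⟩ := Option.isSome_iff_exists.1 hz
    rw [PEquiv.eq_some_iff, leftTrans_apply, Option.some.injEq] at ht
    exact ⟨T.nf t, by rw [← T.nf_gen_mul, ht, hf]⟩

lemma leftTrans_mul {S : Type*} [Monoid S] [IsLeftCancelMul S] (s t : S) :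
    leftTrans (s * t) = (leftTrans t).trans (leftTrans s) := by
  refine PEquiv.ext fun u => ?_
  change some (s * t * u) = some (s * (t * u))
  rw [mul_assoc]

lemma leftTrans_one {S : Type*} [Monoid S] [IsLeftCancelMul S] :
    leftTrans (1 : S) = PEquiv.refl S :=
  PEquiv.ext fun u => by simp

lemma respectsFamilies_leftTrans (s : T) :
    RespectsFamilies (leftTrans s) ∧ RespectsFamilies (leftTrans s).symm := by
  induction s using T.induction with
  | one =>
    rw [leftTrans_one, PEquiv.symm_refl, and_self]
    exact fun f hf => .inl ⟨f, hf, fun z => rfl⟩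
  | mul g s ih =>
    rw [leftTrans_mul, PEquiv.symm_trans_rev]
    exact ⟨ih.1.trans (respectsFamilies_leftTrans_gen g),
      (respectsFamilies_symm_leftTrans_gen g).trans ih.2⟩

/-- The map and its inverse are treated together so that the induction passes through inversion by a
swap. -/
lemma InHull.respectsFamilies {g : T ≃. T} (hg : InHull T g) :
    RespectsFamilies g ∧ RespectsFamilies g.symm := by
  induction hg with
  | of s => exact respectsFamilies_leftTrans s
  | inv _ ih => exact ⟨ih.2, ih.1⟩
  | mul _ _ ih1 ih2 =>
    rw [PEquiv.symm_trans_rev]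
    exact ⟨ih2.1.trans ih1.1, ih1.2.trans ih2.2⟩

/-- The elements `bxₙ` and `byₙ` of `T`. -/
def bxy : ℤ ⊕ ℤ → T
  | .inl n => T.gen .b * T.gen (.x n)
  | .inr n => T.gen .b * T.gen (.y n)

lemma T.nf_bxy (z : ℤ ⊕ ℤ) : T.nf (bxy z) = [.b, shiftLetter 0 0 z] := by
  rcases z with n | n <;> simp only [bxy, shiftLetter, add_zero]
  · rw [T.nf_gen_mul, ← mul_one (T.gen (.x n)), T.nf_gen_mul, T.nf_one]; rfl
  · rw [T.nf_gen_mul, ← mul_one (T.gen (.y n)), T.nf_gen_mul, T.nf_one]; rfl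

lemma bxy_injective : Function.Injective bxy := fun z z' h => by
  have := congrArg T.nf h
  simp only [T.nf_bxy, List.cons.injEq, and_true, true_and] at this
  exact shiftLetter_injective 0 0 this

/-- The partial identity of `Z` respects families; apply this to the family `bxₙ, byₙ`. -/
lemma IsConstructible.bxy_mem_or_finite {Z : Set T} (hZ : IsConstructible T Z) :
    (∀ z, bxy z ∈ Z) ∨ {z | bxy z ∈ Z}.Finite := by
  classical
  obtain ⟨f, -, h⟩ | h := (InHull.respectsFamilies hZ).1 bxy ⟨[.b], 0, 0, T.nf_bxy⟩
  · refine .inl fun z => ?_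
    obtain ⟨h1, h2⟩ := PEquiv.ofSet_eq_some_iff.1 (h z)
    exact h1 ▸ h2
  · refine .inr (h.subset fun z hz => ?_)
    exact Option.isSome_iff_exists.2 ⟨bxy z, PEquiv.ofSet_eq_some_iff.2 ⟨rfl, hz⟩⟩

open scoped Classical in
lemma T.isConstructible_idealX : IsConstructible T T.idealX := by
  refine IsConstructible.of_inHull
    (.mul (.mul (.of (T.gen .a)) (.inv (.of (T.gen .a))))
      (.mul (.of (T.gen .c)) (.inv (.of (T.gen .c))))) _ fun s t => ?_
  simp only [PEquiv.trans_eq_some, PEquiv.eq_some_iff, leftTrans_apply, Option.some.injEq,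
    T.mem_idealX_iff]
  grind

/-! ### The limit character and the failure of C*-regularity -/

/-- A limit point in `Ω(T)` of the points `χ_{bxₙ}`, `χ_{byₙ}`. -/
lemma exists_limit_bxy : ∃ χ : Omega T, ∀ Z : CIdeal T, χ Z = true ↔ ∀ z, bxy z ∈ Z.1 := by
  -- Nonprincipality is all that is used: by the dichotomy the limit does not depend on whether the
  -- ultrafilter lives on the `xₙ` or on the `yₙ`.
  let F : Ultrafilter (Omega T) := (Filter.hyperfilter (ℤ ⊕ ℤ)).map fun z => Omega.pt (bxy z)
  refine ⟨F.lim, fun Z => ?_⟩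
  have key : ∀ v : Bool, F.lim Z = v →
      ∀ᶠ z in Filter.hyperfilter (ℤ ⊕ ℤ), Omega.pt (bxy z) Z = v := by
    intro v hv
    have hc : Continuous fun χ : Omega T => χ Z := (continuous_eval Z).comp continuous_subtype_val
    have hU : IsOpen {χ : Omega T | χ Z = v} := (isOpen_discrete {v}).preimage hc
    exact F.le_nhds_lim (hU.mem_nhds hv)
  constructor
  · intro h
    refine (IsConstructible.bxy_mem_or_finite Z.2).resolve_right fun hf => ?_
    have h1 := key true h
    simp only [Omega.pt_eq_true] at h1
    exact hf.notMem_hyperfilter h1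
  · intro h
    by_contra hv
    have h1 := key false (by simpa using hv)
    obtain ⟨z, hz⟩ := h1.exists
    rw [Omega.pt_eq_true.2 (h z)] at hz
    exact absurd hz (by simp)

/-- The ideal `X` contains all the `bxₙ` and `byₙ`, while each of the finitely many removed ideals
has value `0` and so, by the dichotomy, contains only finitely many. -/
lemma Omega.BarOne.finite_bxy_notMem {χ : Omega T}
    (hχ : ∀ Z : CIdeal T, χ Z = true ↔ ∀ z, bxy z ∈ Z.1) {Z : Set T} (hZ : χ.BarOne Z) :
    {z | bxy z ∉ Z}.Finite := by
  obtain ⟨X, F, hF, rfl, hX, hF0⟩ := hZ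
  refine (hF.biUnion (t := fun Y => {z | bxy z ∈ Y.1}) fun Y hY => ?_).subset fun z hz => ?_
  · refine (IsConstructible.bxy_mem_or_finite Y.2).resolve_left fun h => ?_
    have := hF0 Y hY
    rw [(hχ Y).2 h] at this
    exact absurd this (by simp)
  · simp only [Set.mem_ofPred_eq, Set.mem_sdiff, (hχ X).1 hX z, true_and, not_not] at hz
    simpa using hz

/-- Since `Z` contains almost all `byₙ` and `bxₙ`, it contains some `byₙ`, which `a` moves, and some
`bxₙ`, which `c` moves. -/
lemma Omega.BarOne.exists_act_ne {χ : Omega T}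
    (hχ : ∀ Z : CIdeal T, χ Z = true ↔ ∀ z, bxy z ∈ Z.1) {Z : Set T} (hZ : χ.BarOne Z) :
    (∃ t ∈ Z, T.gen .a * t ≠ t) ∧ ∃ t ∈ Z, T.gen .c * t ≠ t := by
  have h := hZ.finite_bxy_notMem hχ
  constructor
  · obtain ⟨n, hn⟩ := ((h.preimage Sum.inr_injective.injOn).infinite_compl).nonempty
    refine ⟨_, not_not.1 hn, fun H => ?_⟩
    rw [bxy, T.aby] at H
    have := bxy_injective (a₁ := .inr (n + 1)) (a₂ := .inr n) H
    simp at this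
  · obtain ⟨n, hn⟩ := ((h.preimage Sum.inl_injective.injOn).infinite_compl).nonempty
    refine ⟨_, not_not.1 hn, fun H => ?_⟩
    rw [bxy, T.cbx] at H
    have := bxy_injective (a₁ := .inl (n + 1)) (a₂ := .inl n) H
    simp at this

/-- The left alternative holds on the `bxₙT` and the right one on the `byₙT`. In the first, `a`
fixes `ct` as well as `t`, which is what makes the four terms of `(λ_a - 1)(λ_c - 1)δ_t` cancel. -/
lemma T.mul_eq_of_mem_idealX {t : T} (ht : t ∈ T.idealX) :
    T.gen .a * t = t ∧ T.gen .a * (T.gen .c * t) = T.gen .c * t ∨ T.gen .c * t = t := by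
  rcases ht with h | h <;> obtain ⟨n, u, rfl⟩ := Set.mem_iUnion.1 h
  · left
    constructor
    · rw [← mul_assoc, T.abx]
    · rw [← mul_assoc (T.gen .c), T.cbx, ← mul_assoc, T.abx]
  · right
    rw [← mul_assoc, T.cby]

lemma bxy_mem_idealX (z : ℤ ⊕ ℤ) : bxy z ∈ T.idealX := by
  rcases z with n | n
  · exact Or.inl (Set.mem_iUnion.2 ⟨n, 1, mul_one _⟩)
  · exact Or.inr (Set.mem_iUnion.2 ⟨n, 1, mul_one _⟩)

lemma not_isCStarRegular : ¬ IsCStarRegular T := by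
  intro H
  obtain ⟨χ, hχ⟩ := exists_limit_bxy
  obtain ⟨l, Y, κ, hY, hXY, hid⟩ := H 2 ![Hull.of (T.gen .a), Hull.of (T.gen .c)] T.idealX
    ⟨⟨_, T.isConstructible_idealX⟩, ∅, Set.finite_empty, by simp⟩ ⟨_, bxy_mem_idealX (.inl 0)⟩
    fun t ht => by
      simp only [Set.mem_iUnion]
      obtain h | h := T.mul_eq_of_mem_idealX ht
      · exact ⟨0, congrArg some h.1⟩
      · exact ⟨1, congrArg some h⟩
  choose X F hF hYF using hY
  -- Only finitely many ideals describe `X` and the cover, so some `χ_s` agrees with `χ` on all of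
  -- them; a `Y j` containing `s` then also carries `χ`.
  obtain ⟨j, hj⟩ : ∃ j, χ.BarOne (Y j) := by
    obtain ⟨s, hs⟩ := χ.exists_pt (F := {⟨_, T.isConstructible_idealX⟩} ∪ ⋃ j, ({X j} ∪ F j))
      ((Set.finite_singleton _).union
        (Set.finite_iUnion fun j => (Set.finite_singleton _).union (hF j)))
    have h1 : s ∈ T.idealX := by
      have := hs _ (.inl rfl)
      rw [(hχ _).2 bxy_mem_idealX] at this
      exact Omega.pt_eq_true.1 this.symm
    obtain ⟨j, hj⟩ := Set.mem_iUnion.1 (hXY h1)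
    refine ⟨j, X j, F j, hF j, hYF j, ?_, fun W hW => ?_⟩
    · rw [hs _ (.inr (Set.mem_iUnion.2 ⟨j, .inl rfl⟩)), Omega.pt_eq_true]
      rw [hYF j] at hj
      exact hj.1
    · rw [hs _ (.inr (Set.mem_iUnion.2 ⟨j, .inr hW⟩)), ← Bool.not_eq_true, Omega.pt_eq_true]
      rw [hYF j] at hj
      exact fun h => hj.2 (Set.mem_biUnion hW h)
  obtain ⟨⟨s, hs, hs'⟩, t, ht, ht'⟩ := hj.exists_act_ne hχ
  have h2 := hid j
  generalize κ j = k at h2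
  fin_cases k
  · exact hs' (Option.some.inj (h2 s hs))
  · exact ht' (Option.some.inj (h2 t ht))

end Families

end LeftCancelMonoidGpd

namespace GpdCStar

/-! ### Matrix coefficients of operators on `ℓ²` -/

section Delta

variable {ι κ : Type*}

open scoped Classical in
/-- The vector `δ_i ∈ ℓ²(ι)`. -/
def delta (i : ι) : Ell2 ι := lp.single 2 i (1 : ℂ)

open scoped Classical in
lemma delta_apply (i j : ι) : delta i j = if j = i then (1 : ℂ) else 0 := by
  simp [delta, Pi.single_apply]

open scoped Classical in
lemma elim_delta_apply (o : Option ι) (j : ι) :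
    (o.elim 0 delta : Ell2 ι) j = if o = some j then (1 : ℂ) else 0 := by
  rcases o with - | i
  · simp
  · simp [delta_apply, eq_comm]

lemma BEll2.ext_delta {L M : BEll2 ι} (h : ∀ i, L (delta i) = M (delta i)) : L = M := by
  classical
  refine lp.ext_continuousLinearMap (by norm_num) fun i => ?_
  ext j
  simpa [delta] using congrArg (fun ξ : Ell2 ι => ξ j) (h i)

lemma kernelOp_delta {k : ι → ι → ℂ} {C : ℝ} (h : RowColBound k C) (i j : ι) :
    kernelOp k C h (delta j) i = k i j := by
  rw [kernelOp_apply, tsum_eq_single j]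
  · simp [delta_apply]
  · intro v hv
    simp [delta_apply, hv]

lemma ell2Congr_delta (e : ι ≃ κ) (i : ι) : ell2Congr e (delta i) = delta (e i) := by
  ext j
  change delta i (e.symm j) = _
  rw [delta_apply, delta_apply, Equiv.symm_apply_eq]

lemma adjoint_apply_delta (L : BEll2 ι) (i j : ι) :
    (star L) (delta j) i = starRingEnd ℂ (L (delta i) j) := by
  classical
  have h := ContinuousLinearMap.adjoint_inner_right L (delta i) (delta j)
  rw [ContinuousLinearMap.star_eq_adjoint]
  have h1 := lp.inner_single_left (𝕜 := ℂ) (G := fun _ : ι => ℂ) i 1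
    (ContinuousLinearMap.adjoint L (delta j))
  have h2 := lp.inner_single_right (𝕜 := ℂ) (G := fun _ : ι => ℂ) j 1 (L (delta i))
  have h3 : inner ℂ (delta i) (ContinuousLinearMap.adjoint L (delta j)) =
    inner ℂ (L (delta i)) (delta j) := h
  unfold delta at h3 h1 h2 ⊢
  rw [h1, h2] at h3
  simpa using h3

end Delta

section Groupoid

variable {X : Type*} [Groupoid X] [TopologicalSpace (Arr X)] [HasOpenBisections X]

lemma regOp_delta (f : Cc X) (x : X) (g k : SrcFiber x) :
    regOp f x (delta k) g = f.1 ⟨k.1, g.1, Groupoid.inv k.2 ≫ g.2⟩ :=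
  kernelOp_delta _ _ _

end Groupoid

end GpdCStar

namespace LeftCancelMonoidGpd

/-! ### The matrix of `ρ_{χ_e}(f)` -/

section Arrows

variable {S : Type*} [Monoid S] [IsLeftCancelMul S]

lemma mem_D_iff {g : Hull S} {U : Set (Omega S)} {χ ψ : Omega S} {γ : χ ⟶ ψ} :
    (⟨χ, ψ, γ⟩ : Arr (Omega S)) ∈ D g U ↔
      χ ∈ U ∧ ∃ (h : χ g.dom = true) (h' : χ.act g h = ψ), γ = GHom.mk g h h' := by
  constructor
  · rintro ⟨χ', h, hU, H⟩
    obtain ⟨rfl, rfl, H⟩ := Arr.mk.inj H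
    exact ⟨hU, h, rfl, eq_of_heq H⟩
  · rintro ⟨hU, h, rfl, rfl⟩
    exact ⟨χ, h, hU, rfl⟩

/-- The product `[g, r(k)]k`. -/
def srcMul {x : Omega S} (g : Hull S) (k : SrcFiber x) (h : k.1 g.dom = true) : SrcFiber x :=
  ⟨k.1.act g h, k.2 ≫ (GHom.mk g h rfl : k.1 ⟶ k.1.act g h)⟩

lemma inv_comp_mem_D_iff {x : Omega S} {g : Hull S} {U : Set (Omega S)} {k l : SrcFiber x} :
    (⟨k.1, l.1, Groupoid.inv k.2 ≫ l.2⟩ : Arr (Omega S)) ∈ D g U ↔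
      k.1 ∈ U ∧ ∃ h : k.1 g.dom = true, l = srcMul g k h := by
  rw [mem_D_iff]
  obtain ⟨χ, k⟩ := k
  obtain ⟨ψ, l⟩ := l
  dsimp only
  refine and_congr_right fun hU => exists_congr fun h => ?_
  constructor
  · rintro ⟨rfl, H⟩
    refine Sigma.ext rfl (heq_of_eq ?_)
    change l = k ≫ _
    rw [← H]
    simp
  · intro H
    obtain ⟨rfl, H⟩ := Sigma.mk.inj H
    refine ⟨rfl, ?_⟩
    obtain rfl := eq_of_heq H
    change Groupoid.inv k ≫ k ≫ _ = _
    simp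

lemma regOp_indD_delta {x : Omega S} {g : Hull S} {U : Set (Omega S)} (hU : IsClopen U)
    {k : SrcFiber x} (hk : k.1 ∈ U) (h : k.1 g.dom = true) :
    regOp (indD g U hU) x (delta k) = delta (srcMul g k h) := by
  ext l
  rw [regOp_delta, delta_apply]
  change (D g U).indicator (fun _ => (1 : ℂ)) _ = _
  by_cases H : l = srcMul g k h
  · rw [if_pos H]
    exact Set.indicator_of_mem (inv_comp_mem_D_iff.2 ⟨hk, h, H⟩) _
  · rw [if_neg H]
    exact Set.indicator_of_notMem (fun H' => H (inv_comp_mem_D_iff.1 H').2.2) _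

/-- The range belongs to the type of an arrow, so a change of representative is stated for pairs,
where it needs no transport. -/
lemma srcFiber_mk_eq {χ ψ : Omega S} {g g' : Hull S} (hgg' : g = g') {hg : χ g.dom = true}
    {hg' : χ g'.dom = true} (h : χ.act g hg = ψ) :
    (⟨ψ, GHom.mk g hg h⟩ : SrcFiber χ) = ⟨χ.act g' hg', GHom.mk g' hg' rfl⟩ := by
  subst hgg' h; rfl

lemma orbitArr_fst (t : S) : (orbitArr t).1 = Omega.pt t := by
  ext X
  change Omega.pt 1 ((Hull.of t).preim X) = _
  rw [Bool.eq_iff_iff, Omega.pt_eq_true, Omega.pt_eq_true]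
  simp [Hull.preim, Hull.of]

/-- Elements of `I_ℓ(S)` commute with right multiplication, so `g` composed with translation by `t`
is translation by `g(t)`, and `[g, χ_t][t, χ_e] = [g(t), χ_e]`. -/
lemma orbitArr_eq_srcMul_iff {g : Hull S} {s t : S} :
    (∃ h, orbitArr s = srcMul g (orbitArr t) h) ↔ g.1 t = some s := by
  have key : ∀ h, srcMul g (orbitArr t) h =
      ⟨_, GHom.mk (χ := Omega.pt (1 : S)) (g.mul (Hull.of t)) (GHom.comp_dom (Hull.dom_of _ t) rfl h)
        (GHom.comp_act (Hull.dom_of _ t) rfl h rfl)⟩ := by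
    intro h
    refine Sigma.ext rfl (heq_of_eq ?_)
    exact GHom.comp_mk _ _ _ _
  have h0 : ∀ u, g.1 t = some u → g.mul (Hull.of t) = Hull.of u := by
    intro u hu
    refine Subtype.ext (PEquiv.ext fun v => ?_)
    have := g.right_equivariant t v u hu
    exact this
  constructor
  · rintro ⟨h, H⟩
    have h1 := h
    rw [orbitArr_fst, Omega.pt_eq_true] at h1
    obtain ⟨u, hu⟩ := h1
    rw [hu, Option.some.injEq]
    refine (orbitArr_bijective.1 ?_ : u = s)
    rw [H, key, orbitArr]
    exact (srcFiber_mk_eq (h0 u hu) _).symm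
  · intro H
    have h : (orbitArr t).1 g.dom = true := by
      rw [orbitArr_fst, Omega.pt_eq_true]
      exact ⟨s, H⟩
    refine ⟨h, ?_⟩
    rw [key, orbitArr]
    exact (srcFiber_mk_eq (h0 s H) _).symm

/-- The arrow `[s, χ_e][t, χ_e]⁻¹`. -/
def quotArr (s t : S) : Arr (Omega S) :=
  ⟨(orbitArr t).1, (orbitArr s).1, Groupoid.inv (orbitArr t).2 ≫ (orbitArr s).2⟩

lemma quotArr_mem_D_iff {g : Hull S} {U : Set (Omega S)} {s t : S} :
    quotArr s t ∈ D g U ↔ Omega.pt t ∈ U ∧ g.1 t = some s := by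
  rw [quotArr, inv_comp_mem_D_iff, orbitArr_eq_srcMul_iff, orbitArr_fst]

lemma rhoE_toReduced_apply (f : Cc (Omega S)) (ξ : Ell2 S) :
    rhoE S (toReduced f) ξ = (ell2Congr (orbitEquiv S)).symm
      (regOp f (Omega.pt (1 : S)) (ell2Congr (orbitEquiv S) ξ)) := rfl

lemma rhoE_toReduced_delta (f : Cc (Omega S)) (s t : S) :
    rhoE S (toReduced f) (delta t) s = f.1 (quotArr s t) := by
  rw [rhoE_toReduced_apply, ell2Congr_delta]
  exact regOp_delta f _ _ _

end Arrows

/-! ### Diagonal operators in `C*_r(S)` -/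

section Diagonal

variable {S : Type*} [Monoid S] [IsLeftCancelMul S]

open scoped Classical in
lemma rowColBound_diag (F : C(Omega S, ℂ)) :
    RowColBound (fun u t : S => if u = t then F (Omega.pt t) else 0) ‖F‖ := by
  refine ⟨fun u s => ?_, fun t s => ?_⟩ <;> simp only [apply_ite norm, norm_zero]
  · rw [Finset.sum_ite_eq]
    split_ifs
    · exact F.norm_coe_le_norm _
    · exact norm_nonneg _
  · rw [Finset.sum_ite_eq']
    split_ifs
    · exact F.norm_coe_le_norm _
    · exact norm_nonneg _

open scoped Classical in
/-- The operator on `ℓ²(S)` of multiplication by the function `s ↦ F(χ_s)`. -/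
def diagOp (F : C(Omega S, ℂ)) : BEll2 S := kernelOp _ ‖F‖ (rowColBound_diag F)

lemma diagOp_apply (F : C(Omega S, ℂ)) (ξ : Ell2 S) (s : S) :
    diagOp F ξ s = F (Omega.pt s) * ξ s := by
  rw [diagOp, kernelOp_apply, tsum_eq_single s]
  · simp
  · intro t ht
    simp [ht.symm]

lemma diagOp_delta (F : C(Omega S, ℂ)) (t : S) : diagOp F (delta t) = F (Omega.pt t) • delta t := by
  ext s
  rw [diagOp_apply, lp.coeFn_smul, Pi.smul_apply, smul_eq_mul, delta_apply]
  split_ifs with h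
  · rw [h]
  · simp

variable (S) in
lemma isClosed_monoidCStar : IsClosed (MonoidCStar S : Set (BEll2 S)) :=
  NonUnitalStarSubalgebra.isClosed_topologicalClosure _

lemma lam_mem (s : S) : lam s ∈ MonoidCStar S :=
  NonUnitalStarSubalgebra.le_topologicalClosure _ (NonUnitalStarAlgebra.subset_adjoin ℂ _ ⟨s, rfl⟩)

lemma lam_delta (s t : S) : lam s (delta t) = delta (s * t) := lam_single s t

lemma lam_one : lam (1 : S) = 1 := BEll2.ext_delta fun t => by simp [lam_delta]

/-- The elements of `I_ℓ(S)` define operators in `C*_r(S)`. -/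
lemma InHull.exists_mem_monoidCStar {g : S ≃. S} (hg : InHull S g) :
    ∃ L ∈ MonoidCStar S, ∀ t, L (delta t) = (g t).elim 0 delta := by
  induction hg with
  | of s => exact ⟨lam s, lam_mem s, fun t => lam_delta s t⟩
  | @inv g _ ih =>
    classical
    obtain ⟨L, hL, h⟩ := ih
    refine ⟨star L, star_mem hL, fun t => ?_⟩
    ext u
    -- The matrix of `L` has entries `0` and `1`, so its adjoint is the transpose, and `g.symm` is
    -- the transposed relation.
    rw [adjoint_apply_delta, h, elim_delta_apply, elim_delta_apply]
    simp only [g.eq_some_iff]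
    split_ifs <;> simp
  | @mul g h _ _ ih1 ih2 =>
    obtain ⟨L, hL, h1⟩ := ih1
    obtain ⟨M, hM, h2⟩ := ih2
    refine ⟨L * M, mul_mem hL hM, fun t => ?_⟩
    rw [mul_apply_eq_comp, h2]
    change _ = ((h t).bind g).elim 0 delta
    rcases h t with - | v
    · simp
    · simp [h1]

/-- The functions `F ∈ C(Ω(S))` with `diagOp F ∈ C*_r(S)`. -/
def diagSubalgebra (S : Type*) [Monoid S] [IsLeftCancelMul S] :
    StarSubalgebra ℂ C(Omega S, ℂ) where
  carrier := {F | diagOp F ∈ MonoidCStar S}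
  mul_mem' {F G} hF hG := by
    have : diagOp (F * G) = diagOp F * diagOp G := by
      ext ξ s
      simp [diagOp_apply, mul_assoc]
    rw [Set.mem_ofPred_eq, this]
    exact mul_mem hF hG
  add_mem' {F G} hF hG := by
    have : diagOp (F + G) = diagOp F + diagOp G := by
      ext ξ s
      simp [diagOp_apply, add_mul]
    rw [Set.mem_ofPred_eq, this]
    exact add_mem hF hG
  algebraMap_mem' c := by
    have : diagOp (algebraMap ℂ C(Omega S, ℂ) c) = c • lam (1 : S) := by
      ext ξ s
      simp [diagOp_apply, lam_one]
    rw [Set.mem_ofPred_eq, this]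
    exact SMulMemClass.smul_mem c (lam_mem 1)
  star_mem' {F} hF := by
    have : diagOp (star F) = star (diagOp F) := by
      refine BEll2.ext_delta fun t => ?_
      ext s
      rw [adjoint_apply_delta, diagOp_apply, diagOp_apply, delta_apply, delta_apply]
      split_ifs <;> simp_all
    rw [Set.mem_ofPred_eq, this]
    exact star_mem hF

lemma continuous_diagOp : Continuous (diagOp (S := S)) := by
  have hsub : ∀ F G : C(Omega S, ℂ), diagOp F - diagOp G = diagOp (F - G) := fun F G => by
    ext ξ s
    simp [diagOp_apply, sub_mul]
  refine (LipschitzWith.of_dist_le_mul (K := 1) fun F G => ?_).continuous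
  rw [dist_eq_norm, dist_eq_norm, hsub, NNReal.coe_one, one_mul]
  exact (norm_kernelOp_le _).trans_eq (abs_of_nonneg (norm_nonneg _))

open scoped Classical in
/-- The indicator function of a clopen set. -/
def clopenInd {Y : Type*} [TopologicalSpace Y] (U : Set Y) (hU : IsClopen U) : C(Y, ℂ) :=
  ⟨U.indicator fun _ => 1, continuous_const.indicator (by simp [hU.frontier_eq])⟩

/-- By Stone–Weierstrass: the functions with diagonal operator in `C*_r(S)` form a closed unital
`*`-subalgebra, and the indicators of `{χ : χ(p_X) = 1}`, whose operators come from `p_X ∈ I_ℓ(S)`,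
separate points. -/
lemma diagOp_mem (F : C(Omega S, ℂ)) : diagOp F ∈ MonoidCStar S := by
  have hcl : IsClosed (diagSubalgebra S : Set C(Omega S, ℂ)) :=
    (isClosed_monoidCStar S).preimage continuous_diagOp
  have hind : ∀ X : CIdeal S, clopenInd _ (isClopen_eval X) ∈ diagSubalgebra S := by
    classical
    intro X
    obtain ⟨L, hL, h⟩ := InHull.exists_mem_monoidCStar X.2
    have : diagOp (clopenInd _ (isClopen_eval X)) = L := by
      refine BEll2.ext_delta fun t => ?_
      rw [diagOp_delta, h]
      simp only [clopenInd, ContinuousMap.coe_mk, Set.indicator_apply, Set.mem_ofPred_eq,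
        Omega.pt_eq_true]
      by_cases ht : t ∈ X.1
      · rw [if_pos ht, show PEquiv.ofSet X.1 t = some t by simp [ht]]
        simp
      · rw [if_neg ht, show PEquiv.ofSet X.1 t = none by simp [PEquiv.ofSet, ht]]
        simp
    change diagOp (clopenInd _ (isClopen_eval X)) ∈ MonoidCStar S
    rw [this]
    exact hL
  have hsep : (diagSubalgebra S).SeparatesPoints := by
    intro χ ψ hne
    obtain ⟨X, hX⟩ : ∃ X : CIdeal S, χ X ≠ ψ X := by
      by_contra! H
      exact hne (Omega.ext H)
    refine ⟨_, ⟨_, hind X, rfl⟩, ?_⟩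
    simp only [clopenInd, ContinuousMap.coe_mk, Set.indicator_apply, Set.mem_ofPred_eq]
    by_cases h1 : χ X = true <;> by_cases h2 : ψ X = true <;> simp_all
  have h := ContinuousMap.starSubalgebra_topologicalClosure_eq_top_of_separatesPoints
    (diagSubalgebra S) hsep
  have h1 : F ∈ (diagSubalgebra S).topologicalClosure := by rw [h]; trivial
  have h2 : F ∈ closure (diagSubalgebra S : Set C(Omega S, ℂ)) := h1
  rwa [hcl.closure_eq] at h2

end Diagonal

end LeftCancelMonoidGpd

namespace LeftCancelMonoidGpd

/-! ### The values of `ρ_{χ_e}` lie in `C*_r(S)` -/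

section Representation

variable {S : Type*} [Monoid S] [IsLeftCancelMul S]

instance : TotallyDisconnectedSpace (Omega S) :=
  inferInstanceAs (TotallyDisconnectedSpace (Subtype _))

lemma D_eq_image (g : Hull S) (U : Set (Omega S)) :
    D g U = (fun χ : {χ : Omega S // χ g.dom = true} => germArr g χ.1 χ.2) ''
      (Subtype.val ⁻¹' U) := by
  ext γ
  constructor
  · rintro ⟨χ, h, hU, rfl⟩; exact ⟨⟨χ, h⟩, hU, rfl⟩
  · rintro ⟨⟨χ, h⟩, hU, rfl⟩; exact ⟨χ, h, hU, rfl⟩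

lemma isCompact_D (g : Hull S) {U : Set (Omega S)} (hU : IsClosed U) : IsCompact (D g U) := by
  have : CompactSpace {χ : Omega S // χ g.dom = true} :=
    isCompact_iff_compactSpace.1 (isClopen_eval g.dom).isClosed.isCompact
  rw [D_eq_image]
  exact (hU.preimage continuous_subtype_val).isCompact.image (continuous_germArr g)

/-- Since `Ω(S)` is compact, Hausdorff and totally disconnected, the basic sets can be taken over
clopen `U`, which makes them compact. -/
lemma exists_isClopen_D_subset {V : Set (Arr (Omega S))} (hV : IsOpen V) {γ : Arr (Omega S)}
    (hγ : γ ∈ V) : ∃ (g : Hull S) (U : Set (Omega S)), IsClopen U ∧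
      (∀ χ ∈ U, χ g.dom = true) ∧ D g U ⊆ V ∧ γ ∈ D g U := by
  obtain ⟨g, h, H⟩ := exists_germArr γ
  have hdom := (isClopen_eval g.dom).isOpen
  have hW : IsOpen (Subtype.val '' ((fun χ : {χ : Omega S // χ g.dom = true} =>
      germArr g χ.1 χ.2) ⁻¹' V)) :=
    hdom.isOpenMap_subtype_val _ (hV.preimage (continuous_germArr g))
  obtain ⟨U, hU, hγU, hUW⟩ := compact_exists_isClopen_in_isOpen hW (x := γ.src)
    ⟨⟨γ.src, h⟩, by rwa [Set.mem_preimage, ← H], rfl⟩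
  refine ⟨g, U, hU, fun χ hχ => ?_, ?_, γ.src, h, hγU, H⟩
  · obtain ⟨⟨χ, h⟩, -, rfl⟩ := hUW hχ
    exact h
  · rintro _ ⟨χ, h, hχ, rfl⟩
    obtain ⟨⟨χ, h⟩, hV, rfl⟩ := hUW hχ
    exact hV

/-- On the bisection `D(g, U)` the function `f` becomes the function `χ ↦ f([g, χ])` on `U`, and the
operator is multiplication by it followed by the partial isometry of `g`. -/
lemma exists_mem_monoidCStar_indicator_D (g : Hull S) {U : Set (Omega S)} (hU : IsClopen U)
    (hdom : ∀ χ ∈ U, χ g.dom = true) {f : Arr (Omega S) → ℂ} (hf : ContinuousOn f (D g U)) :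
    ∃ L ∈ MonoidCStar S, ∀ s t, L (delta t) s = (D g U).indicator f (quotArr s t) := by
  classical
  let F₀ : Omega S → ℂ := fun χ => if h : χ ∈ U then f (germArr g χ (hdom χ h)) else 0
  have hF₀ : Continuous F₀ := by
    refine continuous_iff_continuousAt.2 fun χ => ?_
    by_cases hχ : χ ∈ U
    · have h1 : ContinuousOn F₀ U := by
        rw [continuousOn_iff_continuous_domRestrict]
        have h2 : U.domRestrict F₀ = fun χ : U => f (germArr g χ.1 (hdom χ.1 χ.2)) :=
          funext fun χ => dif_pos χ.2
        rw [h2]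
        have h3 : Continuous fun χ : U => germArr g χ.1 (hdom χ.1 χ.2) :=
          (continuous_germArr g).comp
            (f := fun χ : U => (⟨χ.1, hdom χ.1 χ.2⟩ : {χ : Omega S // χ g.dom = true}))
            (by fun_prop)
        exact hf.comp_continuous h3 fun χ => ⟨χ.1, hdom χ.1 χ.2, χ.2, rfl⟩
      exact h1.continuousAt (hU.isOpen.mem_nhds hχ)
    · refine (continuousAt_const (y := (0 : ℂ))).congr ?_
      filter_upwards [hU.compl.isOpen.mem_nhds hχ] with ψ hψ
      have h0 : F₀ ψ = 0 := dif_neg hψ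
      exact h0.symm
  obtain ⟨L, hL, h⟩ := InHull.exists_mem_monoidCStar g.2
  refine ⟨L * diagOp ⟨F₀, hF₀⟩, mul_mem hL (diagOp_mem _), fun s t => ?_⟩
  rw [mul_apply_eq_comp, diagOp_delta, map_smul, h, lp.coeFn_smul, Pi.smul_apply,
    elim_delta_apply, Set.indicator_apply]
  simp only [quotArr_mem_D_iff, ContinuousMap.coe_mk, smul_eq_mul, mul_ite, mul_one, mul_zero]
  by_cases hg : g.1 t = some s
  · by_cases ht : Omega.pt t ∈ U
    · simp only [hg, ht, F₀, dif_pos, if_true, and_self]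
      obtain ⟨χ, hχ, -, H⟩ := quotArr_mem_D_iff.2 ⟨ht, hg⟩
      have h1 : Omega.pt t = χ := by
        rw [← orbitArr_fst]
        exact congrArg Arr.src H
      subst h1
      rw [H]
    · simp [hg, ht, F₀]
  · simp [hg]

/-- The bisections are split off one at a time. The groupoid need not be Hausdorff, but inside the
Hausdorff set `V` a compact open bisection is clopen, so cutting `f` along it preserves continuity
on `V`. -/
lemma exists_mem_monoidCStar_of_cover {V : Set (Arr (Omega S))} (hV : IsOpen V) [T2Space V]
    (I : List (Hull S × Set (Omega S)))
    (hI : ∀ p ∈ I, IsClopen p.2 ∧ (∀ χ ∈ p.2, χ p.1.dom = true) ∧ D p.1 p.2 ⊆ V)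
    {f : Arr (Omega S) → ℂ} (hf : ContinuousOn f V) {K : Set (Arr (Omega S))} (hK : IsCompact K)
    (hf0 : ∀ γ, γ ∉ K → f γ = 0) (hcov : ∀ γ ∈ K, ∃ p ∈ I, γ ∈ D p.1 p.2) :
    ∃ L ∈ MonoidCStar S, ∀ s t, L (delta t) s = f (quotArr s t) := by
  classical
  induction I generalizing f K with
  | nil =>
    refine ⟨0, zero_mem _, fun s t => ?_⟩
    rw [hf0 _ fun h => by simpa using hcov _ h]
    rfl
  | cons p I ih =>
    obtain ⟨hU, hdom, hDV⟩ := hI p (by simp)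
    have hopen : IsOpen (V \ D p.1 p.2) := by
      have h1 : IsCompact (Subtype.val ⁻¹' D p.1 p.2 : Set V) :=
        Topology.IsInducing.subtypeVal.isCompact_preimage_iff (by simpa using hDV) |>.2
          (isCompact_D p.1 hU.isClosed)
      have h2 := hV.isOpenMap_subtype_val _ h1.isClosed.isOpen_compl
      rwa [← Set.preimage_compl, Subtype.image_preimage_coe, ← Set.sdiff_eq] at h2
    have hDo := isOpen_D p.1 hU.isOpen
    obtain ⟨L, hL, h⟩ := exists_mem_monoidCStar_indicator_D p.1 hU hdom (hf.mono hDV)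
    have hc : ContinuousOn ((D p.1 p.2)ᶜ.indicator f) V := by
      intro γ hγ
      by_cases hD : γ ∈ D p.1 p.2
      · refine ContinuousAt.continuousWithinAt ((continuousAt_const (y := (0 : ℂ))).congr ?_)
        filter_upwards [hDo.mem_nhds hD] with δ hδ
        exact (Set.indicator_of_notMem (show δ ∉ (D p.1 p.2)ᶜ from fun h => h hδ) _).symm
      · refine ((hf γ hγ).continuousAt (hV.mem_nhds hγ)).congr ?_ |>.continuousWithinAt
        filter_upwards [hopen.mem_nhds ⟨hγ, hD⟩] with δ hδ
        exact (Set.indicator_of_mem (show δ ∈ (D p.1 p.2)ᶜ from hδ.2) _).symm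
    -- The remainder of `f` vanishes off the compact set `K \ D`, which the remaining bisections
    -- cover.
    obtain ⟨M, hM, h'⟩ := ih (fun q hq => hI q (by simp [hq])) hc (hK.diff hDo)
      (fun γ hγ => by
        by_cases hD : γ ∈ D p.1 p.2
        · exact Set.indicator_of_notMem (show γ ∉ (D p.1 p.2)ᶜ from fun h => h hD) _
        · rw [Set.indicator_of_mem (show γ ∈ (D p.1 p.2)ᶜ from hD)]
          exact hf0 γ fun hγK => hγ ⟨hγK, hD⟩)
      (fun γ hγ => by
        obtain ⟨q, hq, hγq⟩ := hcov γ hγ.1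
        rcases List.mem_cons.1 hq with rfl | hq
        · exact absurd hγq hγ.2
        · exact ⟨q, hq, hγq⟩)
    refine ⟨L + M, add_mem hL hM, fun s t => ?_⟩
    rw [add_apply, lp.coeFn_add, Pi.add_apply, h, h']
    exact Set.indicator_self_add_compl_apply _ _ _

lemma exists_mem_monoidCStar_of_mem_Cc {f : Arr (Omega S) → ℂ} (hf : f ∈ Cc (Omega S)) :
    ∃ L ∈ MonoidCStar S, ∀ s t, L (delta t) s = f (quotArr s t) := by
  induction hf using Submodule.span_induction with
  | mem f hf =>
    obtain ⟨V, hV, hT2, hc, K, hK, hKV, h0⟩ := hf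
    choose g U hU hdom hDV hmem using fun γ : V => exists_isClopen_D_subset hV γ.2
    obtain ⟨t, ht⟩ := hK.elim_finite_subcover (fun γ : V => D (g γ) (U γ))
      (fun γ => isOpen_D _ (hU γ).isOpen)
      fun γ hγ => Set.mem_iUnion.2 ⟨⟨γ, hKV hγ⟩, hmem ⟨γ, hKV hγ⟩⟩
    refine exists_mem_monoidCStar_of_cover hV (t.toList.map fun γ => (g γ, U γ)) ?_ hc hK h0 ?_
    · simp only [List.mem_map]
      rintro _ ⟨γ, -, rfl⟩
      exact ⟨hU γ, hdom γ, hDV γ⟩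
    · intro γ hγ
      obtain ⟨δ, hδ, h⟩ := Set.mem_iUnion₂.1 (ht hγ)
      exact ⟨_, List.mem_map.2 ⟨δ, Finset.mem_toList.2 hδ, rfl⟩, h⟩
  | zero => exact ⟨0, zero_mem _, fun s t => rfl⟩
  | add f f' _ _ hf hf' =>
    obtain ⟨L, hL, h⟩ := hf
    obtain ⟨M, hM, h'⟩ := hf'
    refine ⟨L + M, add_mem hL hM, fun s t => ?_⟩
    rw [add_apply, lp.coeFn_add, Pi.add_apply, h, h']
    rfl
  | smul c f _ hf =>
    obtain ⟨L, hL, h⟩ := hf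
    refine ⟨c • L, SMulMemClass.smul_mem c hL, fun s t => ?_⟩
    rw [smul_apply, lp.coeFn_smul, Pi.smul_apply, h]
    rfl

lemma rhoE_toReduced_mem (f : Cc (Omega S)) : rhoE S (toReduced f) ∈ MonoidCStar S := by
  obtain ⟨L, hL, h⟩ := exists_mem_monoidCStar_of_mem_Cc f.2
  have : rhoE S (toReduced f) = L := by
    refine BEll2.ext_delta fun t => ?_
    ext s
    rw [rhoE_toReduced_delta, h]
  rwa [this]

variable (S) in
/-- The representation `rhoE` extended to the product of all `B(ℓ²(𝒢ₓ))`. -/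
def ambientRhoE : RegAmbient (Omega S) →⋆ₙₐ[ℂ] BEll2 S :=
  NonUnitalStarAlgHom.comp
    ((ell2Congr (orbitEquiv S)).symm.conjStarAlgEquiv : _ →⋆ₙₐ[ℂ] BEll2 S)
    (RegAmbient.eval (Omega S) (Omega.pt (1 : S)))

open scoped CStarAlgebra in
lemma rhoE_mem (z : ReducedCStar (Omega S)) : rhoE S z ∈ MonoidCStar S := by
  -- A `*`-homomorphism of C*-algebras is automatically continuous; working on the ambient product
  -- lets the closure defining `C*_r(𝒢)` be pulled back directly.
  have hcont : Continuous (ambientRhoE S) := map_continuous (ambientRhoE S)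
  have hcl : IsClosed ((MonoidCStar S).comap (ambientRhoE S) : Set (RegAmbient (Omega S))) :=
    (isClosed_monoidCStar S).preimage hcont
  have h : ReducedCStar (Omega S) ≤ (MonoidCStar S).comap (ambientRhoE S) := by
    refine NonUnitalStarSubalgebra.topologicalClosure_minimal _ ?_ hcl
    refine NonUnitalStarAlgebra.adjoin_le ?_
    rintro _ ⟨f, rfl⟩
    exact rhoE_toReduced_mem f
  exact h z.2

end Representation

end LeftCancelMonoidGpd

namespace LeftCancelMonoidGpd

/-! ### Images of particular elements, and trivial germs -/

section Representation

variable {S : Type*} [Monoid S] [IsLeftCancelMul S]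

lemma rhoE_indD_of_univ (s : S) :
    rhoE S (toReduced (indD (Hull.of s) Set.univ isClopen_univ)) = lam s := by
  refine BEll2.ext_delta fun t => ?_
  ext u
  rw [rhoE_toReduced_delta, lam_delta, delta_apply]
  change (D _ _).indicator (fun _ => (1 : ℂ)) _ = _
  classical
  rw [Set.indicator_apply]
  simp [quotArr_mem_D_iff, Hull.of, eq_comm]

lemma rhoE_indD_of_one_delta (U : Set (Omega S)) (hU : IsClopen U) (t : S) :
    rhoE S (toReduced (indD (Hull.of 1) U hU)) (delta t) =
      U.indicator (fun _ => delta t) (Omega.pt t) := by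
  ext u
  rw [rhoE_toReduced_delta]
  change (D _ _).indicator (fun _ => (1 : ℂ)) _ = _
  classical
  rw [Set.indicator_apply, Set.indicator_apply]
  by_cases ht : Omega.pt t ∈ U <;> simp [quotArr_mem_D_iff, Hull.of, ht, delta_apply, eq_comm]

lemma srcMul_of_one {x : Omega S} (k : SrcFiber x) : srcMul (Hull.of 1) k k.1.dom_one = k := by
  obtain ⟨χ, k⟩ := k
  have h : (⟨χ.act (Hull.of 1) χ.dom_one, GHom.mk (Hull.of 1) χ.dom_one rfl⟩ : SrcFiber χ) =
      ⟨χ, 𝟙 χ⟩ := (srcFiber_mk_eq rfl χ.act_one).symm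
  calc srcMul (Hull.of 1) ⟨χ, k⟩ χ.dom_one
      = (fun l : SrcFiber χ => (⟨l.1, k ≫ l.2⟩ : SrcFiber x))
        ⟨χ.act (Hull.of 1) χ.dom_one, GHom.mk (Hull.of 1) χ.dom_one rfl⟩ := rfl
    _ = ⟨χ, k⟩ := by rw [h]; simp

/-- The hypothesis says that `[g, χ]` is a unit, that is, has the same germ as translation by `1`.
-/
lemma exists_barOne_of_srcMul_eq {χ : Omega S} {g : Hull S} {h : χ g.dom = true}
    (H : srcMul g (⟨χ, 𝟙 χ⟩ : SrcFiber χ) h = ⟨χ, 𝟙 χ⟩) :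
    ∃ Z, χ.BarOne Z ∧ ∀ s ∈ Z, g.1 s = some s := by
  have h1 := (inv_comp_mem_D_iff (U := Set.univ)).2 ⟨trivial, h, H.symm⟩
  obtain ⟨-, hg, hg', h2⟩ := mem_D_iff.1 h1
  have h3 : GHom.mk (Hull.of 1) χ.dom_one χ.act_one = GHom.mk g hg hg' := by
    rw [← h2]
    change 𝟙 χ = _
    simp
  obtain ⟨Z, hZ, hs⟩ := GHom.mk_eq.1 h3
  exact ⟨Z, hZ, fun s hs' => by rw [← hs s hs']; simp [Hull.of]⟩

end Representation

/-! ### The element of the kernel -/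

section Example

attribute [local instance] T.isLeftCancelMul

/-- The element `(𝟙_{D(a, Ω)} - 𝟙_Ω) * (𝟙_{D(c, Ω)} - 𝟙_Ω) * 𝟙_U` of `C*_r(𝒢(T))`. -/
def kernelElement : ReducedCStar (Omega T) :=
  (toReduced (indD (Hull.of (T.gen .a)) Set.univ isClopen_univ)
      - toReduced (indD (Hull.of 1) Set.univ isClopen_univ))
    * (toReduced (indD (Hull.of (T.gen .c)) Set.univ isClopen_univ)
      - toReduced (indD (Hull.of 1) Set.univ isClopen_univ))
    * toReduced (indD (Hull.of 1) {η : Omega T | η ⟨T.idealX, T.isConstructible_idealX⟩ = true}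
        (isClopen_eval ⟨T.idealX, T.isConstructible_idealX⟩))

lemma rhoE_kernelElement : rhoE T kernelElement = 0 := by
  classical
  refine BEll2.ext_delta fun t => ?_
  rw [kernelElement, map_mul, map_mul, map_sub, map_sub, rhoE_indD_of_univ, rhoE_indD_of_univ,
    rhoE_indD_of_univ, mul_apply_eq_comp, mul_apply_eq_comp, rhoE_indD_of_one_delta,
    Set.indicator_apply]
  simp only [Set.mem_ofPred_eq, Omega.pt_eq_true]
  split_ifs with ht
  -- What remains is `δ_{act} - δ_{at} - (δ_{ct} - δ_t)`. It cancels if `at = t` and `act = ct`, and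
  -- also if `ct = t`.
  · simp only [sub_apply, map_sub, lam_delta, one_mul]
    obtain ⟨h1, h2⟩ | h := T.mul_eq_of_mem_idealX ht
    · simp [h1, h2]
    · simp [h]
  · simp

lemma kernelElement_ne_zero : kernelElement ≠ 0 := by
  intro H
  obtain ⟨χ, hχ⟩ := exists_limit_bxy
  have hne : ∀ g : Gen, g = .a ∨ g = .c → ∀ h,
      srcMul (Hull.of (T.gen g)) (⟨χ, 𝟙 χ⟩ : SrcFiber χ) h ≠ ⟨χ, 𝟙 χ⟩ := by
    intro g hg h H
    obtain ⟨Z, hZ, hid⟩ := exists_barOne_of_srcMul_eq H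
    obtain ⟨⟨s, hs, hs'⟩, t, ht, ht'⟩ := hZ.exists_act_ne hχ
    rcases hg with rfl | rfl
    · exact hs' (Option.some.inj (hid s hs))
    · exact ht' (Option.some.inj (hid t ht))
  -- The coefficient of the element at the unit `χ` is read off in the representation `ρ_χ`; it
  -- would have to be `0`.
  have h0 := congrArg (fun z => rho χ z (delta ⟨χ, 𝟙 χ⟩) ⟨χ, 𝟙 χ⟩) H
  have hU : (⟨χ, 𝟙 χ⟩ : SrcFiber χ).1 ∈
      {η : Omega T | η ⟨T.idealX, T.isConstructible_idealX⟩ = true} :=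
    (hχ _).2 bxy_mem_idealX
  have hone : ∀ (U) (hU : IsClopen U) (k : SrcFiber χ), k.1 ∈ U →
      regOp (indD (Hull.of (1 : T)) U hU) χ (delta k) = delta k := fun U hU k hk => by
    rw [regOp_indD_delta hU hk k.1.dom_one, srcMul_of_one]
  have hof : ∀ (s : T) (k : SrcFiber χ),
      regOp (indD (Hull.of s) Set.univ isClopen_univ) χ (delta k) =
        delta (srcMul (Hull.of s) k (Hull.dom_of _ s)) := fun s k =>
    regOp_indD_delta isClopen_univ trivial _
  simp only [kernelElement, map_mul, map_sub, rho_toReduced, mul_apply_eq_comp, sub_apply,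
    hone _ _ _ hU, hone Set.univ _ _ trivial, hof, map_zero, zero_apply] at h0
  rw [lp.coeFn_sub, Pi.sub_apply, lp.coeFn_sub, Pi.sub_apply, lp.coeFn_sub, Pi.sub_apply] at h0
  rw [lp.coeFn_zero, Pi.zero_apply] at h0
  simp only [delta_apply, (hne .a (.inl rfl) _).symm, (hne .c (.inr rfl) _).symm, if_true,
    if_false] at h0
  -- The terms of `[a, χ]` and `[c, χ]` contribute nothing, so the coefficient is `1`, or `2` if the
  -- germ of `ac` happens to be the unit; both are nonzero, and that germ need not be determined.
  split_ifs at h0 <;> norm_num at h0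

end Example

end LeftCancelMonoidGpd

end

theorem proposition3p2 :
    ∃ _ : IsLeftCancelMul T,
      ¬ IsCStarRegular T ∧
      ∃ (hX : IsConstructible T T.idealX)
        (φ : ReducedCStar (Omega T) →⋆ₙₐ[ℂ] MonoidCStar T),
        (∀ z, (φ z : BEll2 T) = rhoE T z) ∧
        ∃ z : ReducedCStar (Omega T),
          z = (toReduced (indD (Hull.of (T.gen .a)) Set.univ isClopen_univ)
                - toReduced (indD (Hull.of 1) Set.univ isClopen_univ))
              * (toReduced (indD (Hull.of (T.gen .c)) Set.univ isClopen_univ)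
                - toReduced (indD (Hull.of 1) Set.univ isClopen_univ))
              * toReduced (indD (Hull.of 1) {η : Omega T | η ⟨T.idealX, hX⟩ = true}
                  (isClopen_eval ⟨T.idealX, hX⟩)) ∧
          z ≠ 0 ∧ φ z = 0 := by
  have := T.isLeftCancelMul
  exact ⟨T.isLeftCancelMul, not_isCStarRegular, T.isConstructible_idealX,
    NonUnitalStarAlgHom.codRestrict (rhoE T) (MonoidCStar T) rhoE_mem, fun _ => rfl,
    kernelElement, rfl, kernelElement_ne_zero, Subtype.ext rhoE_kernelElement⟩
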